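/- Let $\mathsf X,\mathsf Y$ be Polish spaces with their Borel $\sigma$-algebras. Consider a hidden Markov model with initial law $\chi$ and transition kernel $M(x,dx')=m(x,x')\,\nu(dx')$ on $\mathsf X$ ($\nu$ $\sigma$-finite), and with observation density $g(x,\cdot)$ on $\mathsf Y$ with respect to a $\sigma$-finite measure. Fix $T\in\mathbb N$ and observations $y_0,\dots,y_T$, and put $g_t(x)=g(x,y_t)$. Let $\phi_{0:t|t}$ be the probability measure on $\mathsf X^{t+1}$ proportional to $\chi(dx_0)g_0(x_0)\prod_{u=1}^{t}M(x_{u-1},dx_u)g_u(x_u)$ (the joint smoothing distribution), and let $\phi_t$ be its last marginal (the filter). Auxiliary particle filter with $N\ge1$ particles. Let $\rho_0$ be a probability measure with $\chi\ll\rho_0$, let $\vartheta_t:\mathsf X\to(0,\infty)$ be measurable adjustment multipliers, and let $R_t(x,dx')=r_t(x,x')\,\nu(dx')$ be Markov proposal kernels with $M(x,\cdot)\ll R_t(x,\cdot)$ for all $x$, $t\ge1$. Define the weight functions $$\omega_0(x)=\frac{d\chi}{d\rho_0}(x)\,g_0(x),\qquad \omega_t(x,x')=\frac{m(x,x')g_t(x')}{\vartheta_t(x)r_t(x,x')}\quad(t\ge1),$$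 with $\omega_t(x,x')=0$ where $r_t(x,x')=0$. The initial particles $\xi_0^1,\dots,\xi_0^N$ are i.i.d. with law $\rho_0$, with weights $\omega_0^i=\omega_0(\xi_0^i)$. For $1\le t\le T$, conditionally on all particles and weights up to time $t-1$, the pairs $(I_t^i,\xi_t^i)_{i\le N}$ are i.i.d. with the law on $\{1,\dots,N\}\times\mathsf X$ proportional to $\omega_{t-1}^i\vartheta_t(\xi_{t-1}^i)R_t(\xi_{t-1}^i,dx)$, and $\omega_t^i=\omega_t(\xi_{t-1}^{I_t^i},\xi_t^i)$. Let $A_N$ be the event that $\sum_i\omega_s^i>0$ for all $0\le s\le T$, i.e. that the algorithm never loses all its weights; the conditional laws are only prescribed while this is the case. On $A_N$ the FFBSm estimator is $$\hat\phi_{0:T|T}(h)=\sum_{i_0,\dots,i_T=1}^N\Bigl(\prod_{u=1}^T\frac{\omega_{u-1}^{i_{u-1}}m(\xi_{u-1}^{i_{u-1}},\xi_u^{i_u})}{\sum_{\ell}\omega_{u-1}^{\ell}m(\xi_{u-1}^{\ell},\xi_u^{i_u})}\Bigr)\frac{\omega_T^{i_T}}{\sum_\ell\omega_T^\ell}\,h(\xi_0^{i_0},\dots,\xi_T^{i_T}).$$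 For $0\le t\le T$ and nonnegative measurable $h$ on $\mathsf X^{T+1}$ let $L_{t,T}(x_{0:t},h)=\int\cdots\int\prod_{u=t+1}^TM(x_{u-1},dx_u)g_u(x_u)\,h(x_{0:T})$ and $$F_{t,T}(x_t,h)=\int\cdots\int B_{\phi_{t-1}}(x_t,dx_{t-1})\cdots B_{\phi_0}(x_1,dx_0)\,L_{t,T}(x_{0:t},h),\qquad B_\eta(x,dx')=\frac{\eta(dx')\,m(x',x)}{\int\eta(dz)\,m(z,x)},$$ where $B_\eta(x,\cdot)=0$ if the denominator is $0$ or $\infty$. Write $\operatorname{osc}(h)=\sup_{x,x'}|h(x)-h(x')|$. **Theorem.** Assume that $g_t>0$ for $0\le t\le T$ and that $g_t$ $(0\le t\le T)$, $\vartheta_t$ $(1\le t\le T)$ and $\omega_t$ $(0\le t\le T)$ are bounded ($\omega_0$ up to a $\rho_0$-null set). Then there are constants $B,C\in(0,\infty)$, depending on $T$ and the model and algorithm data $(\chi,m,g,y_{0:T},\rho_0,\vartheta,r)$ only, such that for all $N\ge1$, all $\varepsilon>0$ and all bounded measurable $h:\mathsf X^{T+1}\to\mathbb R$, $$\mathbb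 P\bigl(A_N\cap\{|\hat\phi_{0:T|T}(h)-\phi_{0:T|T}(h)|\ge\varepsilon\}\bigr)\le B\exp\bigl(-CN\varepsilon^2/\operatorname{osc}(h)^2\bigr)$$ (the right-hand side being $0$ if $\operatorname{osc}(h)=0$), and $\mathbb P(A_N^c)\le Be^{-CN}$. In addition, for every $1\le t\le T$, $$N^{-1}\sum_{\ell=1}^N\omega_t^\ell F_{t,T}(\xi_t^\ell,\mathbf 1)\;\longrightarrow\;\frac{\phi_{t-1}[F_{t-1,T}(\cdot,\mathbf 1)]}{\phi_{t-1}(\vartheta_t)}\quad\text{in probability as }N\to\infty .$$ -/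

import Mathlib

open MeasureTheory ProbabilityTheory Filter
open scoped ENNReal NNReal

noncomputable section

/-- A fully dominated hidden Markov model on the state space `X` and the observation space `Y`,
together with a fixed record of observations (only `y 0, …, y T` matter for the horizon `T`). -/
structure HMM (X Y : Type*) [MeasurableSpace X] [MeasurableSpace Y] where
  /-- initial distribution of the state process -/
  χ : Measure X
  isProb_χ : IsProbabilityMeasure χ
  /-- reference measure on the state space -/
  ν : Measure X
  sigmaFinite_ν : SigmaFinite ν
  /-- transition density with respect to `ν` -/
  m : X → X → ℝ≥0
  measurable_m : Measurable (Function.uncurry m)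
  lintegral_m : ∀ x, ∫⁻ x', (m x x' : ℝ≥0∞) ∂ν = 1
  /-- reference measure on the observation space -/
  obsRef : Measure Y
  sigmaFinite_obsRef : SigmaFinite obsRef
  /-- conditional density, with respect to `obsRef`, of the observation given the state -/
  lik : X → Y → ℝ≥0
  measurable_lik : Measurable (Function.uncurry lik)
  lintegral_lik : ∀ x, ∫⁻ y, (lik x y : ℝ≥0∞) ∂obsRef = 1
  /-- the observed values -/
  y : ℕ → Y

attribute [instance] HMM.isProb_χ HMM.sigmaFinite_ν HMM.sigmaFinite_obsRef

namespace HMM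

variable {X Y : Type*} [MeasurableSpace X] [MeasurableSpace Y]

/-- The likelihood function `g_t` of the state at time `t`, given the observation `y_t`. -/
def g (H : HMM X Y) (t : ℕ) (x : X) : ℝ≥0 := H.lik x (H.y t)

/-- The transition kernel `M(x, dx') = m(x, x') ν(dx')`. -/
def M (H : HMM X Y) : Kernel X X :=
  Kernel.withDensity (Kernel.const X H.ν) (fun x x' => (H.m x x' : ℝ≥0∞))

instance (H : HMM X Y) : IsMarkovKernel H.M := by
  refine ⟨fun x => ⟨?_⟩⟩
  have hm : Measurable (Function.uncurry fun x x' => (H.m x x' : ℝ≥0∞)) :=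
    H.measurable_m.coe_nnreal_ennreal
  simp [M, Kernel.withDensity_apply' _ hm, H.lintegral_m x]

/-- The law of `X_{0:t}` (without the observations):
`χ(dx_0) M(x_0, dx_1) ⋯ M(x_{t-1}, dx_t)`. -/
def chainLaw (H : HMM X Y) : (t : ℕ) → Measure (Fin (t + 1) → X)
  | 0 => H.χ.map (fun x _ => x)
  | t + 1 =>
    ((chainLaw H t) ⊗ₘ (H.M.comap (fun x => x (Fin.last t)) (measurable_pi_apply _))).map
      (fun p => (Fin.snoc p.1 p.2 : Fin (t + 2) → X))

/-- The unnormalized joint smoothing distribution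
`χ(dx_0) g_0(x_0) ∏_{u=1}^t M(x_{u-1}, dx_u) g_u(x_u)`. -/
def unnormSmooth (H : HMM X Y) (t : ℕ) : Measure (Fin (t + 1) → X) :=
  (H.chainLaw t).withDensity (fun x => ∏ u : Fin (t + 1), (H.g u (x u) : ℝ≥0∞))

/-- The joint smoothing distribution `φ_{0:t|t}`: the posterior law of `X_{0:t}`
given `y_0, …, y_t`. -/
def smooth (H : HMM X Y) (t : ℕ) : Measure (Fin (t + 1) → X) :=
  (H.unnormSmooth t Set.univ)⁻¹ • H.unnormSmooth t

/-- The filtering distribution `φ_t = φ_{t|t}`: the last marginal of `φ_{0:t|t}`. -/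
def filt (H : HMM X Y) (t : ℕ) : Measure X :=
  (H.smooth t).map (fun x => x (Fin.last t))

/-- The backward kernel
`B_η(x, dx') = η(dx') m(x', x) / ∫ η(dz) m(z, x)`. -/
def backward (H : HMM X Y) (η : Measure X) (x : X) : Measure X :=
  (∫⁻ z, (H.m z x : ℝ≥0∞) ∂η)⁻¹ • η.withDensity (fun x' => (H.m x' x : ℝ≥0∞))

/-- `k` forward steps from time `t`:
`∫⋯∫ ∏_{u=t+1}^{t+k} M(x_{u-1}, dx_u) g_u(x_u) f(x)`; the integration variables replace the
coordinates `t+1, …, t+k` of the sequence `x`. -/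
def forwardInt (H : HMM X Y) (f : (ℕ → X) → ℝ≥0∞) : (k t : ℕ) → (ℕ → X) → ℝ≥0∞
  | 0, _, x => f x
  | k + 1, t, x =>
    ∫⁻ x', (H.g (t + 1) x' : ℝ≥0∞) *
      forwardInt H f k (t + 1) (Function.update x (t + 1) x') ∂(H.M (x t))

/-- The function `L_{t,T}(x_{0:t}, h)`, `t ≤ T`, for nonnegative `h` on `X^{T+1}`. The path
`x_{0:t}` is given by the first coordinates of a sequence, whose other coordinates
have no influence. -/
def L (H : HMM X Y) (t T : ℕ) (x : ℕ → X) (h : (Fin (T + 1) → X) → ℝ≥0∞) : ℝ≥0∞ :=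
  H.forwardInt (fun z => h (fun i => z i)) (T - t) t x

/-- `∫⋯∫ B_{φ_{t-1}}(x_t, dx_{t-1}) ⋯ B_{φ_0}(x_1, dx_0) f(x)`; the integration variables
replace the coordinates `t-1, …, 0` of the sequence `x`. -/
def backwardInt (H : HMM X Y) (f : (ℕ → X) → ℝ≥0∞) : (t : ℕ) → (ℕ → X) → ℝ≥0∞
  | 0, x => f x
  | t + 1, x =>
    ∫⁻ x', backwardInt H f t (Function.update x t x') ∂(H.backward (H.filt t) (x (t + 1)))

/-- `F_{t,T}(x_t, h) =
∫⋯∫ B_{φ_{t-1}}(x_t, dx_{t-1}) ⋯ B_{φ_0}(x_1, dx_0) L_{t,T}(x_{0:t}, h)`. -/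
def F (H : HMM X Y) (t T : ℕ) (xt : X) (h : (Fin (T + 1) → X) → ℝ≥0∞) : ℝ≥0∞ :=
  H.backwardInt (fun x => H.L t T x h) t (fun _ => xt)

end HMM

/-- The user's choices in the auxiliary particle filter for the model `H`: the instrumental
initial law, the adjustment multiplier functions and the proposal densities (used for `t ≥ 1`).
Positivity of the adjustment multipliers and the two domination conditions are what makes the
importance weights well defined as Radon-Nikodym derivatives. -/
structure Proposal {X Y : Type*} [MeasurableSpace X] [MeasurableSpace Y] (H : HMM X Y) where
  /-- law of the initial particles -/
  ρ₀ : Measure X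
  isProb_ρ₀ : IsProbabilityMeasure ρ₀
  /-- adjustment multiplier functions -/
  ϑ : ℕ → X → ℝ≥0
  measurable_ϑ : ∀ t, Measurable (ϑ t)
  ϑ_pos : ∀ t x, 0 < ϑ t x
  /-- proposal densities with respect to `ν` -/
  r : ℕ → X → X → ℝ≥0
  measurable_r : ∀ t, Measurable (Function.uncurry (r t))
  lintegral_r : ∀ t x, ∫⁻ x', (r t x x' : ℝ≥0∞) ∂H.ν = 1
  χ_ac : H.χ ≪ ρ₀
  M_ac : ∀ t x, H.M x ≪ H.ν.withDensity (fun x' => (r t x x' : ℝ≥0∞))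

attribute [instance] Proposal.isProb_ρ₀

namespace Proposal

variable {X Y : Type*} [MeasurableSpace X] [MeasurableSpace Y] {H : HMM X Y}

/-- The proposal kernel `R_t(x, dx') = r_t(x, x') ν(dx')`. -/
def R (Q : Proposal H) (t : ℕ) (x : X) : Measure X :=
  H.ν.withDensity (fun x' => (Q.r t x x' : ℝ≥0∞))

/-- The importance weight function at time `0`. -/
def w₀ (Q : Proposal H) (x : X) : ℝ≥0 := (H.χ.rnDeriv Q.ρ₀ x).toNNReal * H.g 0 x

/-- The importance weight functions at times `t ≥ 1`. -/
def w (Q : Proposal H) (t : ℕ) (x x' : X) : ℝ≥0 :=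
  H.m x x' * H.g t x' / (Q.ϑ t x * Q.r t x x')

/-- The importance weights attached to particles `ξ s i` with ancestor indices `I s i`
(`s ≥ 1`). -/
def wt (Q : Proposal H) {N : ℕ} (ξ : ℕ → Fin N → X) (I : ℕ → Fin N → Fin N) :
    ℕ → Fin N → ℝ≥0
  | 0, i => Q.w₀ (ξ 0 i)
  | s + 1, i => Q.w (s + 1) (ξ s (I (s + 1) i)) (ξ (s + 1) i)

/-- The instrumental distribution on pairs (index, particle) at time `t`, proportional to
`ω_i ϑ_t(x_i) R_t(x_i, dx)`, built on the weighted sample `(x_i, ω_i)` of time `t - 1`. -/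
def instr (Q : Proposal H) {N : ℕ} (t : ℕ) (x : Fin N → X) (ω : Fin N → ℝ≥0) :
    Measure (Fin N × X) :=
  (∑ i, (ω i * Q.ϑ t (x i) : ℝ≥0∞))⁻¹ •
    ∑ i, (ω i * Q.ϑ t (x i) : ℝ≥0∞) • (Q.R t (x i)).map (fun x' => (i, x'))

end Proposal

/-- A run, up to the horizon `T`, of the auxiliary particle filter with `N` particles on the
probability space `(Ω, P)`. The initial particles are i.i.d. with law `ρ₀`. Conditionally on the
particles and weights up to time `t`, the pairs `(I_{t+1}^i, ξ_{t+1}^i)` are i.i.d. with the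
instrumental distribution. This is required on the event that the weights have not all
vanished at some time `s ≤ t`; off this event the instrumental distribution is undefined and
the run is left unconstrained. -/
structure ParticleSystem {X Y : Type*} [MeasurableSpace X] [MeasurableSpace Y] {H : HMM X Y}
    (Q : Proposal H) (T N : ℕ) {Ω : Type*} [MeasurableSpace Ω] (P : Measure Ω) where
  /-- particles -/
  ξ : ℕ → Fin N → Ω → X
  /-- ancestor indices (not used at time `0`) -/
  I : ℕ → Fin N → Ω → Fin N
  measurable_ξ : ∀ s i, Measurable (ξ s i)
  measurable_I : ∀ s i, Measurable (I s i)
  indep_init : iIndepFun (fun i => ξ 0 i) P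
  law_init : ∀ i, P.map (ξ 0 i) = Q.ρ₀
  law_step : ∀ t < T, ∀ E : Set Ω,
    MeasurableSet[⨆ s ≤ t, ⨆ i, MeasurableSpace.comap
      (fun ω => (ξ s i ω, Q.wt (fun s i => ξ s i ω) (fun s i => I s i ω) s i))
        inferInstance] E →
    (∀ ω ∈ E, ∀ s ≤ t, 0 < ∑ i, Q.wt (fun s i => ξ s i ω) (fun s i => I s i ω) s i) →
    ∀ A : Fin N → Set (Fin N × X), (∀ i, MeasurableSet (A i)) →
      P (E ∩ {ω | ∀ i, (I (t + 1) i ω, ξ (t + 1) i ω) ∈ A i}) =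
        ∫⁻ ω in E, ∏ i, Q.instr (t + 1) (fun i => ξ t i ω)
          (Q.wt (fun s i => ξ s i ω) (fun s i => I s i ω) t) (A i) ∂P

namespace ParticleSystem

variable {X Y : Type*} [MeasurableSpace X] [MeasurableSpace Y] {H : HMM X Y} {Q : Proposal H}
  {T N : ℕ} {Ω : Type*} [MeasurableSpace Ω] {P : Measure Ω}

/-- The importance weight `ω_s^i`. -/
def weight (S : ParticleSystem Q T N P) (s : ℕ) (i : Fin N) (ω : Ω) : ℝ≥0 :=
  Q.wt (fun s i => S.ξ s i ω) (fun s i => S.I s i ω) s i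

/-- The event that the total weight is positive at each time `s ≤ T`, that is, that the
algorithm and its estimators are defined. -/
def alive (S : ParticleSystem Q T N P) : Set Ω :=
  {ω | ∀ s ≤ T, 0 < ∑ i, S.weight s i ω}

/-- The FFBSm estimator of `φ_{0:T|T}(h)`. -/
def ffbs (S : ParticleSystem Q T N P) (h : (Fin (T + 1) → X) → ℝ) (ω : Ω) : ℝ :=
  ∑ i : Fin (T + 1) → Fin N,
    (∏ u : Fin T,
      (S.weight u (i u.castSucc) ω : ℝ) *
          H.m (S.ξ u (i u.castSucc) ω) (S.ξ (u + 1) (i u.succ) ω) /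
        ∑ l, (S.weight u l ω : ℝ) * H.m (S.ξ u l ω) (S.ξ (u + 1) (i u.succ) ω)) *
    ((S.weight T (i (Fin.last T)) ω : ℝ) / ∑ l, (S.weight T l ω : ℝ)) *
    h (fun s => S.ξ s (i s) ω)

end ParticleSystem

/-- The oscillation `sup_{x,x'} |h(x) - h(x')|` (for bounded `h`). -/
def osc {Z : Type*} (h : Z → ℝ) : ℝ := ⨆ p : Z × Z, |h p.1 - h p.2|

end

/-! Let `B_t^i(k)` be the mean of `k` along the backward chain started in particle `i` of generation
`t` (`backSmooth`). Summing out the index paths one generation at a time turns the FFBSm estimator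
into the self-normalized average `est` of the `B_t^i(h)` with weights `ω_t^i`, so smoothing can be
analysed by induction on time.

Two facts carry the induction. Given the generations up to `t`, the pairs (ancestor, particle) of
generation `t + 1` are i.i.d., and `ω_{t+1}^i B_{t+1}^i(k)` is a bounded function of the `i`-th pair
and the past. Hence `N⁻¹ ∑ ω_{t+1}^i B_{t+1}^i(k)` obeys a conditional Hoeffding inequality. Its
conditional mean is explicit: the importance weight trades the proposal for `M(x, dx') g_{t+1}(x')`,
and the denominator of the backward step is the density of the resulting mixture, so it cancels
(`sum_integral_backStep`). What remains is `est_t(fwd k) / est_t(ϑ_{t+1})`, a ratio of smoothing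
estimators one step earlier (`integral_instr_backStep`).

By the induction hypothesis this ratio concentrates at `φ_{0:t|t}(fwd k) / φ_t(ϑ_{t+1})`. Dividing
by the same statement for `k = 1` cancels `φ_t(ϑ_{t+1})` and gives concentration of `est_{t+1}(k)`
at `φ_{0:t+1|t+1}(k)`. No random denominator has to be bounded below, because the ratios themselves
are bounded: `|est k| ≤ sup |k|` and `|fwd k| ≤ sup ω_{t+1} · ϑ_{t+1}`.

Zero weights need care. Almost surely no ancestor of zero weight is drawn, so every particle of
positive weight has a nonzero backward denominator (`ae_reachable`) and its backward chain has mass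
one. Extinction at time `t` means that `N⁻¹ ∑ ω_t^i` misses its positive limit by the whole limit,
an exponentially unlikely deviation.

The law of large numbers is the unnormalized inequality for `k` proportional to `F_{t+1,T}(·, 1)` of
the last coordinate. Its limit is identified by the fact that, `φ_t`-almost everywhere, the backward
kernels are probabilities and leave the forward mass unchanged. -/

/-! ### Hoeffding inequalities and a quotient bound -/

/-- Hoeffding's inequality for the empirical mean of independent, bounded variables. -/
lemma hoeffding_abs_mean {Ω : Type*} [MeasurableSpace Ω] {P : Measure Ω} [IsProbabilityMeasure P]
    {N : ℕ} (hN : 1 ≤ N) {X : Fin N → Ω → ℝ} (hind : iIndepFun X P)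
    (hm : ∀ i, AEMeasurable (X i) P) {K : ℝ} (hK : 0 < K) (hb : ∀ i, ∀ᵐ ω ∂P, |X i ω| ≤ K)
    {a : ℝ} (ha : ∀ i, ∫ ω, X i ω ∂P = a) {ε : ℝ} (hε : 0 < ε) :
    P.real {ω | ε ≤ |(N : ℝ)⁻¹ * ∑ i, X i ω - a|} ≤
      2 * Real.exp (-(N * ε ^ 2 / (2 * K ^ 2))) := by
  have hN' : (0 : ℝ) < N := by exact_mod_cast hN
  have key : ∀ Z : Fin N → Ω → ℝ, iIndepFun Z P →
      (∀ i, HasSubgaussianMGF (Z i) ((‖K - -K‖₊ / 2) ^ 2) P) →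
      P.real {ω | N * ε ≤ ∑ i, Z i ω} ≤ Real.exp (-(N * ε ^ 2 / (2 * K ^ 2))) := by
    intro Z hZ hs
    have h := HasSubgaussianMGF.measure_sum_ge_le_of_iIndepFun hZ (s := Finset.univ)
      (fun i _ => hs i) (ε := N * ε) (by positivity)
    refine h.trans (le_of_eq ?_)
    have e : (‖K - -K‖ / 2) ^ 2 = K ^ 2 := by
      rw [Real.norm_of_nonneg (by linarith)]; ring
    congr 1
    simp only [Finset.sum_const, Finset.card_univ, Fintype.card_fin]
    push_cast
    rw [nsmul_eq_mul, e]
    field_simp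
  have hs : ∀ i, HasSubgaussianMGF (fun ω => X i ω - a) ((‖K - -K‖₊ / 2) ^ 2) P := by
    intro i
    have := hasSubgaussianMGF_of_mem_Icc (hm i) (a := -K) (b := K)
      ((hb i).mono fun ω h => by simpa [Set.mem_Icc, abs_le] using h)
    rwa [ha i] at this
  have h1 := key (fun i ω => X i ω - a)
    (hind.comp (fun _ x => x - a) (fun _ => by fun_prop)) hs
  have h2 := key (fun i ω => -(X i ω - a))
    (hind.comp (fun _ x => -(x - a)) (fun _ => by fun_prop)) (fun i => (hs i).neg)
  refine (measureReal_mono (s₂ := {ω | N * ε ≤ ∑ i, (X i ω - a)} ∪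
    {ω | N * ε ≤ ∑ i, -(X i ω - a)}) ?_).trans ((measureReal_union_le _ _).trans ?_)
  · intro ω hω
    simp only [Set.mem_ofPred_eq, Set.mem_union] at hω ⊢
    have e : ∑ i, (X i ω - a) = N * ((N : ℝ)⁻¹ * ∑ i, X i ω - a) := by
      rw [Finset.sum_sub_distrib]; simp; field_simp
    rw [Finset.sum_neg_distrib, e, ← mul_neg]
    rcases le_abs'.1 hω with h | h
    · right; gcongr; linarith
    · left; gcongr
  · linarith

/-- Hoeffding's inequality for variables that are conditionally i.i.d. with law `κ (V ω)`, on the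
event `V ∈ G`. -/
lemma conditional_hoeffding {Ω D Z : Type*} [MeasurableSpace Ω] [MeasurableSpace D]
    [MeasurableSpace Z] [Nonempty Z] {P : Measure Ω} [IsProbabilityMeasure P]
    {N : ℕ} (hN : 1 ≤ N) {V : Ω → D} (hV : Measurable V) {ζ : Fin N → Ω → Z}
    (hζ : ∀ i, Measurable (ζ i)) {G : Set D} (hG : MeasurableSet G) {κ : D → Measure Z}
    (hκ : Measurable κ) (hκp : ∀ d ∈ G, IsProbabilityMeasure (κ d))
    (hlaw : ∀ E, MeasurableSet E → E ⊆ G → ∀ A : Fin N → Set Z, (∀ i, MeasurableSet (A i)) →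
      P (V ⁻¹' E ∩ {ω | ∀ i, ζ i ω ∈ A i}) = ∫⁻ ω in V ⁻¹' E, ∏ i, κ (V ω) (A i) ∂P)
    {f : D → Z → ℝ} (hf : Measurable (Function.uncurry f)) {K : ℝ} (hK : 0 < K)
    (hfK : ∀ d ∈ G, ∀ᵐ z ∂κ d, |f d z| ≤ K) {ε : ℝ} (hε : 0 < ε) :
    P.real (V ⁻¹' G ∩ {ω | ε ≤ |(N : ℝ)⁻¹ * ∑ i, f (V ω) (ζ i ω) - ∫ z, f (V ω) z ∂κ (V ω)|}) ≤
      2 * Real.exp (-(N * ε ^ 2 / (2 * K ^ 2))) := by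
  classical
  obtain ⟨z₀⟩ := ‹Nonempty Z›
  -- Off `G` the measure `κ d` need not be a probability; a Dirac mass there yields a Markov kernel
  -- without affecting the event `V ∈ G`.
  let κ' : D → Measure Z := fun d => if d ∈ G then κ d else Measure.dirac z₀
  have hκ'm : Measurable κ' := Measurable.ite hG hκ measurable_const
  have hκ'p : ∀ d, IsProbabilityMeasure (κ' d) := by
    intro d
    by_cases hd : d ∈ G
    · simpa [κ', hd] using hκp d hd
    · simpa [κ', hd] using Measure.dirac.isProbabilityMeasure
  let κk : Kernel D Z := ⟨κ', hκ'm⟩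
  have : IsMarkovKernel κk := ⟨hκ'p⟩
  let κN : Kernel D (Fin N → Z) := ⟨fun d => Measure.pi fun _ => κ' d, by
    refine Measurable.measure_of_isPiSystem_of_isProbabilityMeasure generateFrom_pi.symm
      isPiSystem_pi ?_
    rintro s ⟨A, hA, rfl⟩
    simp only [Measure.pi_pi]
    exact Finset.measurable_prod _ fun i _ =>
      (Measure.measurable_coe (hA i (Set.mem_univ i))).comp hκ'm⟩
  have : IsMarkovKernel κN := ⟨fun d => by dsimp [κN]; infer_instance⟩
  set μ := P.restrict (V ⁻¹' G)
  have hζ' : Measurable (fun ω i => ζ i ω) := measurable_pi_lambda _ hζ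
  -- The box identities determine the joint law of `V` and the sample on `V ∈ G`; after that the
  -- unconditional inequality applies for each frozen value of `V`.
  have hlaw' : μ.map (fun ω => (V ω, fun i => ζ i ω)) = (μ.map V) ⊗ₘ κN := by
    refine Measure.ext_prod_iff.2 fun {E B} hE hB => ?_
    have hL : ∀ B, MeasurableSet B → (μ.map (fun ω => (V ω, fun i => ζ i ω))) (E ×ˢ B) =
        ((P.restrict (V ⁻¹' (E ∩ G))).map (fun ω i => ζ i ω)) B := by
      intro B hB
      rw [Measure.map_apply (hV.prodMk hζ') (hE.prod hB), Measure.map_apply hζ' hB,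
        Measure.restrict_apply (hV.prodMk hζ' (hE.prod hB)), Measure.restrict_apply (hζ' hB)]
      congr 1; ext ω; simp; tauto
    have hR : ∀ B, MeasurableSet B → ((μ.map V) ⊗ₘ κN) (E ×ˢ B) =
        ((((μ.map V).restrict E) ⊗ₘ κN).snd) B := by
      intro B hB
      rw [Measure.compProd_apply_prod hE hB, Measure.snd_apply hB,
        show Prod.snd ⁻¹' B = (Set.univ : Set D) ×ˢ B by ext; simp,
        Measure.compProd_apply_prod .univ hB, Measure.restrict_univ]
    -- For fixed `E` both sides are finite measures in `B`, so agreement on boxes and on the total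
    -- mass is enough.
    rw [hL B hB, hR B hB]
    congr 1
    refine ext_of_generate_finite _ generateFrom_pi.symm isPiSystem_pi ?_ ?_
    · rintro s ⟨A, hA, rfl⟩
      have hA' : ∀ i, MeasurableSet (A i) := fun i => hA i (Set.mem_univ i)
      rw [← hR _ (MeasurableSet.univ_pi hA'), Measure.compProd_apply_prod hE
        (MeasurableSet.univ_pi hA'), Measure.map_apply hζ' (MeasurableSet.univ_pi hA'),
        Measure.restrict_apply (hζ' (MeasurableSet.univ_pi hA')), Set.inter_comm]
      have := hlaw (E ∩ G) (hE.inter hG) Set.inter_subset_right A hA'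
      rw [show (fun ω i => ζ i ω) ⁻¹' (Set.univ.pi A) = {ω | ∀ i, ζ i ω ∈ A i} by
        ext; simp, this, setLIntegral_map hE (κN.measurable_coe (MeasurableSet.univ_pi hA')) hV,
        Measure.restrict_restrict (hV hE), ← Set.preimage_inter]
      refine setLIntegral_congr_fun (hV (hE.inter hG)) fun ω hω => ?_
      have : V ω ∈ G := hω.2
      have := hκp _ this
      simp only [κN, κ', Kernel.coe_mk, if_pos hω.2, Measure.pi_pi]
    · rw [← hR _ .univ, Measure.compProd_apply_prod hE .univ, Measure.map_apply hζ' .univ]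
      simp [μ, Measure.map_apply hV hE, Measure.restrict_apply (hV hE)]
  have h_integral : Measurable fun d => ∫ z, f d z ∂κ' d := by
    have := hf.stronglyMeasurable.integral_kernel_prod_right' (κ := κk)
    exact this.measurable
  set S : Set (D × (Fin N → Z)) :=
    {p | ε ≤ |(N : ℝ)⁻¹ * ∑ i, f p.1 (p.2 i) - ∫ z, f p.1 z ∂κ' p.1|}
  have hS : MeasurableSet S := by
    refine measurableSet_le measurable_const (Measurable.abs (Measurable.sub ?_ ?_))
    · refine Measurable.const_mul (Finset.measurable_sum _ fun i _ => ?_) _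
      exact hf.comp (measurable_fst.prodMk ((measurable_pi_apply i).comp measurable_snd))
    · exact h_integral.comp measurable_fst
  have hset : P (V ⁻¹' G ∩ {ω | ε ≤ |(N : ℝ)⁻¹ * ∑ i, f (V ω) (ζ i ω) -
      ∫ z, f (V ω) z ∂κ (V ω)|}) = μ.map (fun ω => (V ω, fun i => ζ i ω)) S := by
    rw [Measure.map_apply (hV.prodMk hζ') hS,
      Measure.restrict_apply (hV.prodMk hζ' hS), Set.inter_comm]
    congr 1; ext ω
    simp only [Set.mem_inter_iff, Set.mem_preimage, Set.mem_ofPred_eq, S, κ']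
    refine and_congr_left fun hω => by rw [if_pos hω]
  refine ENNReal.toReal_le_of_le_ofReal (by positivity) ?_
  rw [hset, hlaw', Measure.compProd_apply hS]
  calc ∫⁻ d, κN d (Prod.mk d ⁻¹' S) ∂(μ.map V)
      ≤ ∫⁻ _, ENNReal.ofReal (2 * Real.exp (-(N * ε ^ 2 / (2 * K ^ 2)))) ∂(μ.map V) := by
        have hG1 : ∀ᵐ d ∂(μ.map V), d ∈ G :=
          (ae_map_iff hV.aemeasurable hG).2 (ae_restrict_mem (hV hG))
        refine lintegral_mono_ae (hG1.mono fun d hd => ?_)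
        have hd' : κ' d = κ d := by simp [κ', hd]
        have hfd : Measurable (f d) := hf.comp measurable_prodMk_left
        have hmp := fun i : Fin N => measurePreserving_eval (fun _ : Fin N => κ' d) i
        have h := hoeffding_abs_mean (P := κN d) hN
          (X := fun i z => f d (z i)) (iIndepFun_pi (μ := fun _ => κ' d)
            fun _ => hfd.aemeasurable)
          (fun i => (hfd.comp (measurable_pi_apply i)).aemeasurable) hK
          (fun i => (hmp i).quasiMeasurePreserving.ae (by rw [hd']; exact hfK d hd))
          (a := ∫ z, f d z ∂κ' d)
          (fun i => by
            rw [← (hmp i).map_eq, integral_map (hmp i).measurable.aemeasurable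
              hfd.aestronglyMeasurable]
            rfl) hε
        rw [measureReal_def] at h
        exact (ENNReal.le_ofReal_iff_toReal_le (measure_ne_top _ _) (by positivity)).2 h
    _ ≤ ENNReal.ofReal (2 * Real.exp (-(N * ε ^ 2 / (2 * K ^ 2)))) := by
        rw [lintegral_const]
        refine mul_le_of_le_one_right' ?_
        rw [Measure.map_apply hV .univ]
        exact (Measure.restrict_le_self _).trans prob_le_one

/-- Comparison of two quotients; the first denominator is not required to be bounded below. -/
lemma abs_div_sub_div_le {a b a' b' c : ℝ} (hb : b ≠ 0) (hb' : 0 < b') (hab : |a / b| ≤ c) :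
    |a / b - a' / b'| ≤ (|a - a'| + c * |b - b'|) / b' := by
  -- Here `b` is in a denominator only within `a / b`, which is bounded by `c`.
  have e : a / b - a' / b' = ((a - a') + (a / b) * (b' - b)) / b' := by field_simp; ring
  rw [e, abs_div, abs_of_pos hb', abs_sub_comm b]
  gcongr
  exact (abs_add_le _ _).trans (by rw [abs_mul]; gcongr)

/-! ### Backward smoothing along a weighted particle cloud -/

namespace HMM

variable {X Y : Type*} [MeasurableSpace X] [MeasurableSpace Y] {N : ℕ}

/-- Backward smoothing along a weighted particle cloud `d s i = (particle, weight)`: the mean of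
`h` under the backward chain started at time `t` in the particle with index `i`. -/
noncomputable def backSmooth (H : HMM X Y) (d : ℕ → Fin N → X × ℝ≥0) :
    (t : ℕ) → Fin N → ((Fin (t + 1) → X) → ℝ) → ℝ
  | 0, i, h => h (fun _ => (d 0 i).1)
  | t + 1, i, h =>
    (∑ l, ((d t l).2 : ℝ) * H.m (d t l).1 (d (t + 1) i).1 *
      backSmooth H d t l (fun z => h (Fin.snoc z (d (t + 1) i).1))) /
      ∑ l, ((d t l).2 : ℝ) * H.m (d t l).1 (d (t + 1) i).1

/-- Backward smoothing from the point `x` at time `t + 1`. -/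
noncomputable def backStep (H : HMM X Y) (d : ℕ → Fin N → X × ℝ≥0) (t : ℕ) (x : X)
    (h : (Fin (t + 2) → X) → ℝ) : ℝ :=
  (∑ l, ((d t l).2 : ℝ) * H.m (d t l).1 x * H.backSmooth d t l (fun z => h (Fin.snoc z x))) /
    ∑ l, ((d t l).2 : ℝ) * H.m (d t l).1 x

/-- The weighted sum `∑ ω_t^i B_t^i(h)` over the particles at time `t`. -/
noncomputable def unnormEst (H : HMM X Y) (d : ℕ → Fin N → X × ℝ≥0) (t : ℕ)
    (h : (Fin (t + 1) → X) → ℝ) : ℝ :=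
  ∑ i, ((d t i).2 : ℝ) * H.backSmooth d t i h

/-- The self-normalized smoothing estimator at time `t`. -/
noncomputable def est (H : HMM X Y) (d : ℕ → Fin N → X × ℝ≥0) (t : ℕ)
    (h : (Fin (t + 1) → X) → ℝ) : ℝ :=
  H.unnormEst d t h / ∑ i, ((d t i).2 : ℝ)

/-- Each particle with positive weight can be reached from the preceding generation, up to
time `t`. -/
def Reachable (H : HMM X Y) (d : ℕ → Fin N → X × ℝ≥0) (t : ℕ) : Prop :=
  ∀ s < t, ∀ i, 0 < (d (s + 1) i).2 →
    0 < ∑ l, ((d s l).2 : ℝ) * H.m (d s l).1 (d (s + 1) i).1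

variable {H : HMM X Y} {d : ℕ → Fin N → X × ℝ≥0}

lemma backSmooth_congr {d' : ℕ → Fin N → X × ℝ≥0} {t : ℕ} (hd : ∀ s ≤ t, d s = d' s)
    (i : Fin N) (h : (Fin (t + 1) → X) → ℝ) : H.backSmooth d t i h = H.backSmooth d' t i h := by
  induction t generalizing i with
  | zero => simp [backSmooth, hd 0 le_rfl]
  | succ t ih =>
    simp only [backSmooth, hd (t + 1) le_rfl, hd t (Nat.le_succ t),
      ih fun s hs => hd s (hs.trans (Nat.le_succ t))]

lemma backStep_congr {d' : ℕ → Fin N → X × ℝ≥0} {t : ℕ} (hd : ∀ s ≤ t, d s = d' s)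
    (x : X) (h : (Fin (t + 2) → X) → ℝ) : H.backStep d t x h = H.backStep d' t x h := by
  simp only [backStep, hd t le_rfl, backSmooth_congr hd]

lemma est_congr {d' : ℕ → Fin N → X × ℝ≥0} {t : ℕ} (hd : ∀ s ≤ t, d s = d' s)
    (h : (Fin (t + 1) → X) → ℝ) : H.est d t h = H.est d' t h := by
  simp only [est, unnormEst, hd t le_rfl, backSmooth_congr hd]

lemma backSmooth_linear (t : ℕ) (i : Fin N) (a b : ℝ) (h k : (Fin (t + 1) → X) → ℝ) :
    H.backSmooth d t i (fun z => a * h z + b * k z) =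
      a * H.backSmooth d t i h + b * H.backSmooth d t i k := by
  induction t generalizing i with
  | zero => simp [backSmooth]
  | succ t ih =>
    simp only [backSmooth, ih]
    rw [← mul_div_assoc, ← mul_div_assoc, ← add_div, Finset.mul_sum, Finset.mul_sum,
      ← Finset.sum_add_distrib]
    congr 1
    exact Finset.sum_congr rfl fun l _ => by ring

lemma unnormEst_linear (t : ℕ) (a b : ℝ) (h k : (Fin (t + 1) → X) → ℝ) :
    H.unnormEst d t (fun z => a * h z + b * k z) =
      a * H.unnormEst d t h + b * H.unnormEst d t k := by
  simp only [unnormEst, backSmooth_linear, Finset.mul_sum, ← Finset.sum_add_distrib]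
  exact Finset.sum_congr rfl fun l _ => by ring

lemma est_linear (t : ℕ) (a b : ℝ) (h k : (Fin (t + 1) → X) → ℝ) :
    H.est d t (fun z => a * h z + b * k z) = a * H.est d t h + b * H.est d t k := by
  rw [est, unnormEst_linear]; simp only [est]; ring

lemma est_const_mul (t : ℕ) (a : ℝ) (h : (Fin (t + 1) → X) → ℝ) :
    H.est d t (fun z => a * h z) = a * H.est d t h := by
  simpa using est_linear (H := H) (d := d) t a 0 h h

lemma abs_backSmooth_le {t : ℕ} (i : Fin N) {h k : (Fin (t + 1) → X) → ℝ}
    (hk : ∀ z, |h z| ≤ k z) : |H.backSmooth d t i h| ≤ H.backSmooth d t i k := by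
  induction t generalizing i with
  | zero => exact hk _
  | succ t ih =>
    simp only [backSmooth]
    rw [abs_div, abs_of_nonneg (a := ∑ l, ((d t l).2 : ℝ) * H.m (d t l).1 (d (t + 1) i).1)
      (by positivity)]
    gcongr
    refine (Finset.abs_sum_le_sum_abs _ _).trans (Finset.sum_le_sum fun l _ => ?_)
    rw [abs_mul, abs_of_nonneg (by positivity)]
    gcongr
    exact ih l fun z => hk _

/-- Only an inequality in general: where a backward denominator vanishes, division by zero gives `0`
and mass is lost. Equality is recovered from `Reachable`. -/
lemma backSmooth_const_le (t : ℕ) (i : Fin N) {c : ℝ} (hc : 0 ≤ c) :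
    H.backSmooth d t i (fun _ => c) ≤ c := by
  induction t generalizing i with
  | zero => exact le_rfl
  | succ t ih =>
    simp only [backSmooth]
    refine div_le_of_le_mul₀ (by positivity) hc ?_
    rw [Finset.mul_sum]
    refine Finset.sum_le_sum fun l _ => ?_
    rw [mul_comm c]
    gcongr
    exact ih l

lemma abs_backSmooth_le_const {t : ℕ} (i : Fin N) {h : (Fin (t + 1) → X) → ℝ} {c : ℝ}
    (hc : 0 ≤ c) (hh : ∀ z, |h z| ≤ c) : |H.backSmooth d t i h| ≤ c :=
  (abs_backSmooth_le i hh).trans (backSmooth_const_le t i hc)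

lemma abs_backStep_le_const {t : ℕ} (x : X) {h : (Fin (t + 2) → X) → ℝ} {c : ℝ}
    (hc : 0 ≤ c) (hh : ∀ z, |h z| ≤ c) : |H.backStep d t x h| ≤ c := by
  have h0 : 0 ≤ ∑ l, ((d t l).2 : ℝ) * H.m (d t l).1 x := by positivity
  rw [backStep, abs_div, abs_of_nonneg h0]
  refine div_le_of_le_mul₀ h0 hc ?_
  rw [Finset.mul_sum]
  refine (Finset.abs_sum_le_sum_abs _ _).trans (Finset.sum_le_sum fun l _ => ?_)
  rw [abs_mul, abs_of_nonneg (by positivity), mul_comm c]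
  gcongr
  exact abs_backSmooth_le_const l hc fun z => hh _

lemma abs_est_le {t : ℕ} {h k : (Fin (t + 1) → X) → ℝ} (hk : ∀ z, |h z| ≤ k z) :
    |H.est d t h| ≤ H.est d t k := by
  rw [est, est, abs_div, abs_of_nonneg (a := ∑ i, ((d t i).2 : ℝ)) (by positivity)]
  gcongr
  refine (Finset.abs_sum_le_sum_abs _ _).trans (Finset.sum_le_sum fun l _ => ?_)
  rw [abs_mul, abs_of_nonneg (by positivity)]
  gcongr
  exact abs_backSmooth_le l hk

lemma abs_est_le_const {t : ℕ} {h : (Fin (t + 1) → X) → ℝ} {c : ℝ} (hc : 0 ≤ c)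
    (hk : ∀ z, |h z| ≤ c) : |H.est d t h| ≤ c := by
  refine (abs_est_le hk).trans (div_le_of_le_mul₀ (by positivity) hc ?_)
  rw [unnormEst, Finset.mul_sum]
  refine Finset.sum_le_sum fun l _ => ?_
  rw [mul_comm c]
  gcongr
  exact backSmooth_const_le t l hc

lemma Reachable.mono {s t : ℕ} (hd : H.Reachable d t) (hst : s ≤ t) : H.Reachable d s :=
  fun u hu => hd u (hu.trans_le hst)

/-- The start of the backward chain fixes the last coordinate, so the claim amounts to the chain
having mass one. Constants are themselves functions of the last coordinate, so the induction
hypothesis supplies this mass at each predecessor of positive weight. -/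
lemma Reachable.backSmooth_last {t : ℕ} (hd : H.Reachable d t) (i : Fin N)
    (hi : 0 < (d t i).2) (f : X → ℝ) :
    H.backSmooth d t i (fun z => f (z (Fin.last t))) = f (d t i).1 := by
  induction t generalizing i f with
  | zero => rfl
  | succ t ih =>
    have hpos := hd t (Nat.lt_succ_self t) i hi
    simp only [backSmooth, Fin.snoc_last]
    rw [div_eq_iff hpos.ne', Finset.mul_sum]
    refine Finset.sum_congr rfl fun l _ => ?_
    rcases eq_or_ne (d t l).2 0 with h0 | h0
    · simp [h0]
    · rw [ih (hd.mono (Nat.le_succ t)) l (pos_iff_ne_zero.2 h0) (fun _ => f (d (t + 1) i).1)]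
      ring

lemma Reachable.unnormEst_last {t : ℕ} (hd : H.Reachable d t) (f : X → ℝ) :
    H.unnormEst d t (fun z => f (z (Fin.last t))) = ∑ i, ((d t i).2 : ℝ) * f (d t i).1 := by
  refine Finset.sum_congr rfl fun i _ => ?_
  rcases eq_or_ne (d t i).2 0 with h0 | h0
  · simp [h0]
  · rw [hd.backSmooth_last i (pos_iff_ne_zero.2 h0)]

lemma Reachable.unnormEst_one {t : ℕ} (hd : H.Reachable d t) :
    H.unnormEst d t (fun _ => 1) = ∑ i, ((d t i).2 : ℝ) := by
  simpa using hd.unnormEst_last (fun _ => 1)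

lemma Reachable.est_one {t : ℕ} (hd : H.Reachable d t) (hpos : 0 < ∑ i, (d t i).2) :
    H.est d t (fun _ => 1) = 1 := by
  rw [est, hd.unnormEst_one, div_self]
  exact_mod_cast hpos.ne'

lemma measurable_snoc {n : ℕ} :
    Measurable fun p : (Fin n → X) × X => (Fin.snoc p.1 p.2 : Fin (n + 1) → X) := by
  refine measurable_pi_lambda _ fun j => ?_
  refine Fin.lastCases ?_ (fun j => ?_) j
  · simpa using measurable_snd
  · simp only [Fin.snoc_castSucc]
    fun_prop

lemma measurable_backSmooth {A : Type*} [MeasurableSpace A] {δ : A → ℕ → Fin N → X × ℝ≥0}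
    (hδ : Measurable δ) {t : ℕ} (i : Fin N) {h : A → (Fin (t + 1) → X) → ℝ}
    (hh : Measurable (Function.uncurry h)) :
    Measurable fun a => H.backSmooth (δ a) t i (h a) := by
  have hδ' : ∀ s i, Measurable fun a => δ a s i := fun s i => by fun_prop
  induction t generalizing i with
  | zero =>
    exact hh.comp (measurable_id.prodMk (measurable_pi_lambda _ fun _ => (hδ' 0 i).fst))
  | succ t ih =>
    have hm : ∀ l, Measurable fun a => ((δ a t l).2 : ℝ) * H.m (δ a t l).1 (δ a (t + 1) i).1 := by
      intro l
      exact (hδ' t l).snd.coe_nnreal_real.mul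
        (H.measurable_m.comp ((hδ' t l).fst.prodMk (hδ' (t + 1) i).fst)).coe_nnreal_real
    refine (Finset.measurable_sum _ fun l _ => (hm l).mul (ih l ?_)).div
      (Finset.measurable_sum _ fun l _ => hm l)
    exact hh.comp (measurable_fst.prodMk (measurable_snoc.comp
      (measurable_snd.prodMk ((hδ' (t + 1) i).fst.comp measurable_fst))))

lemma measurable_backStep {A : Type*} [MeasurableSpace A] {δ : A → ℕ → Fin N → X × ℝ≥0}
    (hδ : Measurable δ) {x : A → X} (hx : Measurable x) {t : ℕ}
    {h : (Fin (t + 2) → X) → ℝ} (hh : Measurable h) :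
    Measurable fun a => H.backStep (δ a) t (x a) h := by
  have hδ' : ∀ s i, Measurable fun a => δ a s i := fun s i => by fun_prop
  have hm : ∀ l, Measurable fun a => ((δ a t l).2 : ℝ) * H.m (δ a t l).1 (x a) := fun l =>
    (hδ' t l).snd.coe_nnreal_real.mul
        (H.measurable_m.comp ((hδ' t l).fst.prodMk hx)).coe_nnreal_real
  refine (Finset.measurable_sum _ fun l _ => (hm l).mul (measurable_backSmooth hδ l ?_)).div
      (Finset.measurable_sum _ fun l _ => hm l)
  exact hh.comp (measurable_snoc.comp (measurable_snd.prodMk (hx.comp measurable_fst)))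

/-- The backward recursion sums over all index paths. -/
lemma sum_paths_eq_sum_backSmooth (t : ℕ) (c : Fin N → ℝ) (h : (Fin (t + 1) → X) → ℝ) :
    ∑ i : Fin (t + 1) → Fin N,
      (∏ u : Fin t, ((d u (i u.castSucc)).2 : ℝ) *
          H.m (d u (i u.castSucc)).1 (d (u + 1) (i u.succ)).1 /
        ∑ l, ((d u l).2 : ℝ) * H.m (d u l).1 (d (u + 1) (i u.succ)).1) *
      c (i (Fin.last t)) * h (fun s => (d s (i s)).1) = ∑ j, c j * H.backSmooth d t j h := by
  induction t generalizing c with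
  | zero =>
    rw [← (Equiv.funUnique (Fin 1) (Fin N)).symm.sum_comp]
    refine Finset.sum_congr rfl fun j _ => ?_
    simp only [Finset.univ_eq_empty, Finset.prod_empty, one_mul, backSmooth]
    congr 2
    funext s
    obtain rfl : s = 0 := Fin.fin_one_eq_zero s
    rfl
  | succ t ih =>
    rw [← (Fin.snocEquiv fun _ : Fin (t + 2) => Fin N).sum_comp, Fintype.sum_prod_type]
    refine Finset.sum_congr rfl fun j _ => ?_
    -- With the last index fixed at `j`, the factor leading into `j` plays the role of the final
    -- weight; this is why `c` is arbitrary in the induction.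
    have := ih (fun l => ((d t l).2 : ℝ) * H.m (d t l).1 (d (t + 1) j).1 /
      ∑ l, ((d t l).2 : ℝ) * H.m (d t l).1 (d (t + 1) j).1)
      (fun z => h (Fin.snoc z (d (t + 1) j).1))
    have e : ∑ l, ((d t l).2 : ℝ) * H.m (d t l).1 (d (t + 1) j).1 /
      (∑ l, ((d t l).2 : ℝ) * H.m (d t l).1 (d (t + 1) j).1) *
        H.backSmooth d t l (fun z => h (Fin.snoc z (d (t + 1) j).1)) =
        H.backSmooth d (t + 1) j h := by
      simp only [backSmooth, Finset.sum_div]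
      exact Finset.sum_congr rfl fun l _ => by ring
    rw [← e, ← this, Finset.mul_sum]
    refine Finset.sum_congr rfl fun i _ => ?_
    rw [Fin.prod_univ_castSucc]
    have hpath : (fun s : Fin (t + 2) => (d s ((Fin.snocEquiv fun _ => Fin N) (j, i) s)).1) =
        Fin.snoc (fun s : Fin (t + 1) => (d s (i s)).1) (d (t + 1) j).1 := by
      funext s
      refine Fin.lastCases ?_ (fun s => ?_) s <;> simp
    rw [hpath]
    simp only [Fin.snocEquiv_apply, Fin.snoc_castSucc, Fin.snoc_last, Fin.succ_last,
      Fin.succ_castSucc, Fin.val_castSucc, Fin.val_last]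
    ring

end HMM

namespace ParticleSystem

variable {X Y : Type*} [MeasurableSpace X] [MeasurableSpace Y] {H : HMM X Y} {Q : Proposal H}
  {T N : ℕ} {Ω : Type*} [MeasurableSpace Ω] {P : Measure Ω}

/-- The weighted particle cloud. -/
noncomputable def cloud (S : ParticleSystem Q T N P) (ω : Ω) (s : ℕ) (i : Fin N) : X × ℝ≥0 :=
  (S.ξ s i ω, S.weight s i ω)

lemma ffbs_eq_est (S : ParticleSystem Q T N P) (h : (Fin (T + 1) → X) → ℝ) (ω : Ω) :
    S.ffbs h ω = H.est (S.cloud ω) T h := by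
  have := HMM.sum_paths_eq_sum_backSmooth (H := H) (d := S.cloud ω) T
    (fun i => (S.weight T i ω : ℝ) / ∑ l, (S.weight T l ω : ℝ)) h
  rw [HMM.est, HMM.unnormEst, Finset.sum_div]
  refine Eq.trans ?_ (this.trans ?_)
  · rfl
  · exact Finset.sum_congr rfl fun l _ => by simp only [cloud]; ring

end ParticleSystem

/-! ### Forward recursion of the smoothing distributions -/

namespace HMM

variable {X Y : Type*} [MeasurableSpace X] [MeasurableSpace Y] {H : HMM X Y}

lemma measurable_g (H : HMM X Y) (t : ℕ) : Measurable (H.g t) :=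
  H.measurable_lik.comp (measurable_id.prodMk measurable_const)

lemma measurable_m_mul_g (H : HMM X Y) (t : ℕ) :
    Measurable (Function.uncurry fun x x' => (H.m x x' : ℝ≥0∞) * H.g t x') :=
  H.measurable_m.coe_nnreal_ennreal.mul
    ((H.measurable_g t).comp measurable_snd).coe_nnreal_ennreal

/-- The unnormalized prediction-correction kernel `M(x, dx') g_t(x')`. -/
noncomputable def MG (H : HMM X Y) (t : ℕ) : Kernel X X :=
  Kernel.withDensity (Kernel.const X H.ν) (fun x x' => (H.m x x' : ℝ≥0∞) * H.g t x')

instance (t : ℕ) : IsSFiniteKernel (H.MG t) :=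
  Kernel.IsSFiniteKernel.withDensity _ fun _ _ => ENNReal.mul_ne_top ENNReal.coe_ne_top
    ENNReal.coe_ne_top

lemma MG_apply (H : HMM X Y) (t : ℕ) (x : X) :
    H.MG t x = H.ν.withDensity (fun x' => (H.m x x' : ℝ≥0∞) * H.g t x') := by
  simp [MG, Kernel.withDensity_apply _ (H.measurable_m_mul_g t)]

lemma M_apply (H : HMM X Y) (x : X) :
    H.M x = H.ν.withDensity (fun x' => (H.m x x' : ℝ≥0∞)) := by
  have hm : Measurable (Function.uncurry fun x x' => (H.m x x' : ℝ≥0∞)) :=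
    H.measurable_m.coe_nnreal_ennreal
  simp [M, Kernel.withDensity_apply _ hm]

lemma measurable_m_left (H : HMM X Y) (x : X) : Measurable (H.m x) :=
  H.measurable_m.comp measurable_prodMk_left

lemma lintegral_MG (t : ℕ) (x : X) {f : X → ℝ≥0∞} (hf : Measurable f) :
    ∫⁻ x', f x' ∂H.MG t x = ∫⁻ x', (H.g t x' : ℝ≥0∞) * f x' ∂H.M x := by
  have hg := (H.measurable_g t).coe_nnreal_ennreal
  have hm := (H.measurable_m_left x).coe_nnreal_ennreal
  have hmg : Measurable fun x' => (H.m x x' : ℝ≥0∞) * H.g t x' := hm.mul hg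
  have hgf : Measurable fun x' => (H.g t x' : ℝ≥0∞) * f x' := hg.mul hf
  rw [MG_apply, M_apply, lintegral_withDensity_eq_lintegral_mul _ hmg hf,
    lintegral_withDensity_eq_lintegral_mul _ hm hgf]
  simp [mul_assoc]

lemma MG_univ_le {t : ℕ} {K : ℝ≥0} (hK : ∀ x, H.g t x ≤ K) (x : X) :
    H.MG t x Set.univ ≤ K := by
  rw [← lintegral_one, lintegral_MG t x measurable_const]
  calc ∫⁻ x', (H.g t x' : ℝ≥0∞) * 1 ∂H.M x ≤ ∫⁻ _, K ∂H.M x :=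
        lintegral_mono fun x' => by simpa using hK x'
    _ = K := by simp

lemma isFiniteKernel_MG {t : ℕ} {K : ℝ≥0} (hK : ∀ x, H.g t x ≤ K) : IsFiniteKernel (H.MG t) :=
  ⟨K, ENNReal.coe_lt_top, MG_univ_le hK⟩

lemma MG_ne_zero {t : ℕ} (hg : ∀ x, 0 < H.g t x) (x : X) : H.MG t x Set.univ ≠ 0 := by
  rw [← lintegral_one, lintegral_MG t x measurable_const, ← pos_iff_ne_zero]
  simp only [mul_one]
  rw [lintegral_pos_iff_support (H.measurable_g t).coe_nnreal_ennreal]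
  have : (Function.support fun x' => (H.g t x' : ℝ≥0∞)) = Set.univ := by
    ext x'; simp [(hg x').ne']
  rw [this]; simp

instance (t : ℕ) : IsProbabilityMeasure (H.chainLaw t) := by
  induction t with
  | zero => exact Measure.isProbabilityMeasure_map (by fun_prop)
  | succ t ih => exact Measure.isProbabilityMeasure_map measurable_snoc.aemeasurable

/-- The kernel `MG` read off the last coordinate of a path. -/
noncomputable def stepKernel (H : HMM X Y) (t : ℕ) : Kernel (Fin (t + 1) → X) X :=
  (H.MG (t + 1)).comap (fun z => z (Fin.last t)) (measurable_pi_apply _)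

instance (t : ℕ) : IsSFiniteKernel (H.stepKernel t) := by unfold stepKernel; infer_instance

lemma measurable_prod_g (H : HMM X Y) (t : ℕ) :
    Measurable fun x : Fin (t + 1) → X => ∏ u : Fin (t + 1), (H.g u (x u) : ℝ≥0∞) :=
  Finset.measurable_prod _ fun u _ =>
    ((H.measurable_g u).comp (measurable_pi_apply u)).coe_nnreal_ennreal

instance (t : ℕ) : SFinite (H.unnormSmooth t) := by unfold unnormSmooth; infer_instance

instance (t : ℕ) : SFinite (H.smooth t) := by unfold smooth; infer_instance

/-- The last factor of the likelihood product is moved from the density into the transition kernel.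
-/
lemma unnormSmooth_succ (H : HMM X Y) (t : ℕ) :
    H.unnormSmooth (t + 1) = ((H.unnormSmooth t) ⊗ₘ H.stepKernel t).map
      (fun p => (Fin.snoc p.1 p.2 : Fin (t + 2) → X)) := by
  refine Measure.ext_of_lintegral _ fun f hf => ?_
  have hg := (H.measurable_g (t + 1)).coe_nnreal_ennreal
  have hfs : Measurable fun p : (Fin (t + 1) → X) × X =>
    f (Fin.snoc p.1 p.2 : Fin (t + 2) → X) := hf.comp measurable_snoc
  have hP := H.measurable_prod_g (t + 1)
  have hPf : Measurable fun p : (Fin (t + 1) → X) × X =>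
      ((fun x : Fin (t + 2) → X => ∏ u : Fin (t + 2), (H.g u (x u) : ℝ≥0∞)) * f) (Fin.snoc p.1 p.2) :=
    (hP.mul hf).comp measurable_snoc
  rw [unnormSmooth, lintegral_withDensity_eq_lintegral_mul _ hP hf, chainLaw,
    lintegral_map (hP.mul hf) measurable_snoc,
    Measure.lintegral_compProd hPf,
    lintegral_map hf measurable_snoc, Measure.lintegral_compProd hfs, unnormSmooth,
    lintegral_withDensity_eq_lintegral_mul _ (H.measurable_prod_g t)
      hfs.lintegral_kernel_prod_right']
  refine lintegral_congr fun z => ?_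
  simp only [Pi.mul_apply, stepKernel, Kernel.comap_apply]
  have hfz : Measurable fun x => f (Fin.snoc z x : Fin (t + 2) → X) :=
    hfs.comp measurable_prodMk_left
  have hgf : Measurable fun x =>
      (H.g (t + 1) x : ℝ≥0∞) * f (Fin.snoc z x : Fin (t + 2) → X) := hg.mul hfz
  rw [lintegral_MG _ _ hfz, ← lintegral_const_mul _ hgf]
  refine lintegral_congr fun x => ?_
  rw [Fin.prod_univ_castSucc]
  simp [mul_assoc]

lemma unnormSmooth_univ_ne_zero {t : ℕ} (hg : ∀ s ≤ t, ∀ x, 0 < H.g s x) :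
    H.unnormSmooth t Set.univ ≠ 0 := by
  rw [unnormSmooth, withDensity_apply _ .univ, Measure.restrict_univ, ← pos_iff_ne_zero,
    lintegral_pos_iff_support (H.measurable_prod_g t)]
  have : (Function.support fun x : Fin (t + 1) → X =>
      ∏ u : Fin (t + 1), (H.g u (x u) : ℝ≥0∞)) = Set.univ := by
    ext x
    simp only [Function.mem_support, Set.mem_univ, iff_true, Finset.prod_ne_zero_iff]
    intro u _
    simpa using (hg u (Nat.lt_succ_iff.1 u.2) (x u)).ne'
  rw [this]; simp

lemma unnormSmooth_univ_ne_top {t : ℕ} {K : ℝ≥0} (hK : ∀ s ≤ t, ∀ x, H.g s x ≤ K) :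
    H.unnormSmooth t Set.univ ≠ ∞ := by
  rw [unnormSmooth, withDensity_apply _ .univ, Measure.restrict_univ]
  refine ne_top_of_le_ne_top (b := ∫⁻ _, (K : ℝ≥0∞) ^ (t + 1) ∂H.chainLaw t) (by simp) ?_
  refine lintegral_mono fun x => ?_
  calc ∏ u : Fin (t + 1), (H.g u (x u) : ℝ≥0∞) ≤ ∏ _u : Fin (t + 1), (K : ℝ≥0∞) :=
        Finset.prod_le_prod' fun u _ => by
          exact_mod_cast hK u (Nat.lt_succ_iff.1 u.2) (x u)
    _ = _ := by simp

lemma isProbabilityMeasure_smooth {t : ℕ} (hg : ∀ s ≤ t, ∀ x, 0 < H.g s x) {K : ℝ≥0}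
    (hK : ∀ s ≤ t, ∀ x, H.g s x ≤ K) : IsProbabilityMeasure (H.smooth t) :=
  ⟨by simp [smooth, ENNReal.inv_mul_cancel (unnormSmooth_univ_ne_zero hg)
    (unnormSmooth_univ_ne_top hK)]⟩

lemma exists_smooth_succ {t : ℕ} (hg : ∀ s ≤ t + 1, ∀ x, 0 < H.g s x) {K : ℝ≥0}
    (hK : ∀ s ≤ t + 1, ∀ x, H.g s x ≤ K) :
    ∃ c : ℝ≥0∞, c ≠ 0 ∧ c ≠ ∞ ∧ H.smooth (t + 1) = c • ((H.smooth t) ⊗ₘ H.stepKernel t).map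
      (fun p => (Fin.snoc p.1 p.2 : Fin (t + 2) → X)) := by
  have h0 := unnormSmooth_univ_ne_zero fun s hs => hg s (hs.trans (Nat.le_succ t))
  have h1 := unnormSmooth_univ_ne_top fun s hs => hK s (hs.trans (Nat.le_succ t))
  have h0' := unnormSmooth_univ_ne_zero hg
  have h1' := unnormSmooth_univ_ne_top hK
  refine ⟨H.unnormSmooth t Set.univ * (H.unnormSmooth (t + 1) Set.univ)⁻¹,
    mul_ne_zero h0 (ENNReal.inv_ne_zero.2 h1'), ENNReal.mul_ne_top h1 (ENNReal.inv_ne_top.2 h0'), ?_⟩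
  rw [smooth, smooth, Measure.compProd_smul_left, Measure.map_smul, ← unnormSmooth_succ,
    smul_smul, mul_right_comm, ENNReal.mul_inv_cancel h0 h1, one_mul]

/-- `h ↦ ∫ M(x_t, dx) g_{t+1}(x) h(x_{0:t}, x)`. -/
noncomputable def fwd (H : HMM X Y) (t : ℕ) (k : (Fin (t + 2) → X) → ℝ) (z : Fin (t + 1) → X) : ℝ :=
  ∫ x, k (Fin.snoc z x) ∂(H.MG (t + 1) (z (Fin.last t)))

lemma measurable_fwd {t : ℕ} {k : (Fin (t + 2) → X) → ℝ} (hk : Measurable k) :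
    Measurable (H.fwd t k) := by
  have := (hk.comp (measurable_snoc (X := X) (n := t + 1))).stronglyMeasurable.integral_kernel_prod_right'
    (κ := H.stepKernel t)
  exact this.measurable

lemma abs_fwd_le {t : ℕ} {k : (Fin (t + 2) → X) → ℝ} {K : ℝ≥0} (hK : ∀ x, H.g (t + 1) x ≤ K)
    (hk : ∀ z, |k z| ≤ 1) (z : Fin (t + 1) → X) : |H.fwd t k z| ≤ K := by
  have := isFiniteKernel_MG hK
  refine (norm_integral_le_of_norm_le_const (f := fun x => k (Fin.snoc z x))
    (C := 1) (ae_of_all _ fun x => hk _)).trans ?_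
  rw [one_mul, measureReal_def]
  exact ENNReal.toReal_le_coe_of_le_coe (MG_univ_le hK _)

lemma fwd_one_pos {t : ℕ} {K : ℝ≥0} (hK : ∀ x, H.g (t + 1) x ≤ K) (hg : ∀ x, 0 < H.g (t + 1) x)
    (z : Fin (t + 1) → X) : 0 < H.fwd t (fun _ => 1) z := by
  have := isFiniteKernel_MG hK
  simp only [fwd, integral_const, smul_eq_mul, mul_one]
  exact ENNReal.toReal_pos (MG_ne_zero hg _) (measure_ne_top _ _)

lemma integral_pos_of_pos {α : Type*} [MeasurableSpace α] {μ : Measure α} [IsProbabilityMeasure μ]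
    {f : α → ℝ} (hf : Integrable f μ) (h : ∀ x, 0 < f x) : 0 < ∫ x, f x ∂μ := by
  rw [integral_pos_iff_support_of_nonneg (fun x => (h x).le) hf]
  have : Function.support f = Set.univ := by ext x; simp [(h x).ne']
  simp [this]

lemma integrable_of_abs_le {α : Type*} [MeasurableSpace α] {μ : Measure α} [IsFiniteMeasure μ]
    {f : α → ℝ} (hf : Measurable f) {c : ℝ} (h : ∀ x, |f x| ≤ c) : Integrable f μ :=
  Integrable.of_bound hf.aestronglyMeasurable c (ae_of_all _ h)

lemma integral_fwd_one_pos {t : ℕ} (hg : ∀ s ≤ t + 1, ∀ x, 0 < H.g s x) {K : ℝ≥0}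
    (hK : ∀ s ≤ t + 1, ∀ x, H.g s x ≤ K) : 0 < ∫ z, H.fwd t (fun _ => 1) z ∂H.smooth t := by
  have := isProbabilityMeasure_smooth (fun s hs => hg s (hs.trans (Nat.le_succ t)))
    (fun s hs => hK s (hs.trans (Nat.le_succ t)))
  exact integral_pos_of_pos (integrable_of_abs_le (measurable_fwd measurable_const)
    (abs_fwd_le (hK _ le_rfl) (by simp))) (fwd_one_pos (hK _ le_rfl) (hg _ le_rfl))

/-- The normalizing constant of the recursion is eliminated by testing with `k = 1`. -/
lemma integral_smooth_succ {t : ℕ} (hg : ∀ s ≤ t + 1, ∀ x, 0 < H.g s x) {K : ℝ≥0}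
    (hK : ∀ s ≤ t + 1, ∀ x, H.g s x ≤ K) {k : (Fin (t + 2) → X) → ℝ} (hk : Measurable k)
    (hk1 : ∀ z, |k z| ≤ 1) :
    ∫ z, k z ∂H.smooth (t + 1) =
      (∫ z, H.fwd t k z ∂H.smooth t) / ∫ z, H.fwd t (fun _ => 1) z ∂H.smooth t := by
  have := isProbabilityMeasure_smooth (fun s hs => hg s (hs.trans (Nat.le_succ t)))
    (fun s hs => hK s (hs.trans (Nat.le_succ t)))
  have := isProbabilityMeasure_smooth hg hK
  have := isFiniteKernel_MG (hK (t + 1) le_rfl)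
  have : IsFiniteKernel (H.stepKernel t) := by unfold stepKernel; infer_instance
  obtain ⟨c, -, -, hc⟩ := exists_smooth_succ hg hK
  have key : ∀ k : (Fin (t + 2) → X) → ℝ, Measurable k → (∀ z, |k z| ≤ 1) →
      ∫ z, k z ∂H.smooth (t + 1) = c.toReal * ∫ z, H.fwd t k z ∂H.smooth t := by
    intro k hk hk1
    rw [hc, integral_smul_measure, smul_eq_mul, integral_map measurable_snoc.aemeasurable
      hk.aestronglyMeasurable, Measure.integral_compProd]
    · rfl
    · exact integrable_of_abs_le (hk.comp measurable_snoc) fun p => hk1 _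
  have h1 := key (fun _ => 1) measurable_const (by simp)
  have hpos := integral_fwd_one_pos hg hK
  rw [key k hk hk1]
  simp only [integral_const, probReal_univ, smul_eq_mul, mul_one] at h1
  rw [eq_div_iff hpos.ne', mul_right_comm, ← h1, one_mul]

lemma integral_smooth_zero {k : (Fin 1 → X) → ℝ} (hk : Measurable k) :
    ∫ z, k z ∂H.smooth 0 =
      (∫ x, (H.g 0 x : ℝ) * k (fun _ => x) ∂H.χ) / ∫ x, (H.g 0 x : ℝ) ∂H.χ := by
  have hc : Measurable fun (x : X) (_ : Fin 1) => x := by fun_prop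
  have key : ∀ k : (Fin 1 → X) → ℝ, Measurable k →
      ∫ z, k z ∂H.unnormSmooth 0 = ∫ x, (H.g 0 x : ℝ) * k (fun _ => x) ∂H.χ := by
    intro k hk
    have hg : Measurable fun x : Fin (0 + 1) → X => H.g 0 (x 0) :=
      (H.measurable_g 0).comp (measurable_pi_apply 0)
    have e : (fun x : Fin (0 + 1) → X => ∏ u : Fin (0 + 1), (H.g u (x u) : ℝ≥0∞)) =
      fun x => (H.g 0 (x 0) : ℝ≥0∞) := by funext x; simp
    rw [unnormSmooth, e, integral_withDensity_eq_integral_smul hg, chainLaw,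
      integral_map hc.aemeasurable]
    · rfl
    · exact (hg.smul hk).aestronglyMeasurable
  have hu : (H.unnormSmooth 0 Set.univ).toReal = ∫ x, (H.g 0 x : ℝ) ∂H.χ := by
    have := key (fun _ => 1) measurable_const
    simpa [measureReal_def] using this
  rw [smooth, integral_smul_measure, key k hk, ENNReal.toReal_inv, hu, smul_eq_mul, div_eq_inv_mul]

end HMM

/-! ### Time reversal for the particle cloud -/

namespace HMM

variable {X Y : Type*} [MeasurableSpace X] [MeasurableSpace Y] {H : HMM X Y} {N : ℕ}
  {d : ℕ → Fin N → X × ℝ≥0}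

/-- The backward chain from particle `i` only sees paths ending there. This freezes the measure `MG
(t + 1) (z (Fin.last t))` in `fwd` at one particle, as the exchange of integrals requires. -/
lemma backSmooth_congr_last {t : ℕ} (i : Fin N) {h k : (Fin (t + 1) → X) → ℝ}
    (hk : ∀ z, z (Fin.last t) = (d t i).1 → h z = k z) :
    H.backSmooth d t i h = H.backSmooth d t i k := by
  cases t with
  | zero => exact hk _ rfl
  | succ t =>
    simp only [backSmooth]
    congr 1
    refine Finset.sum_congr rfl fun l _ => ?_
    congr 2
    funext z
    exact hk _ (by simp)

lemma measurable_backSmooth_right {t : ℕ} (i : Fin N) {A : Type*} [MeasurableSpace A]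
    {k : (Fin (t + 1) → X) → A → ℝ} (hk : Measurable (Function.uncurry k)) :
    Measurable fun x => H.backSmooth d t i (fun z => k z x) :=
  measurable_backSmooth (h := fun x z => k z x) measurable_const i (hk.comp measurable_swap)

/-- For a fixed cloud, backward smoothing is a finite linear combination of point evaluations, so it
commutes with integration over a parameter. -/
lemma backSmooth_integral {A : Type*} [MeasurableSpace A] {μ : Measure A} [IsFiniteMeasure μ]
    {t : ℕ} (i : Fin N) {k : (Fin (t + 1) → X) → A → ℝ} (hk : Measurable (Function.uncurry k))
    (hk1 : ∀ z x, |k z x| ≤ 1) :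
    H.backSmooth d t i (fun z => ∫ x, k z x ∂μ) = ∫ x, H.backSmooth d t i (fun z => k z x) ∂μ := by
  induction t generalizing i with
  | zero => rfl
  | succ t ih =>
    have hks : Measurable (Function.uncurry fun (z : Fin (t + 1) → X) x =>
        k (Fin.snoc z (d (t + 1) i).1) x) :=
      hk.comp ((measurable_snoc.comp (measurable_fst.prodMk measurable_const)).prodMk
        measurable_snd)
    simp only [backSmooth]
    rw [integral_div, integral_finsetSum]
    · congr 1
      refine Finset.sum_congr rfl fun l _ => ?_
      rw [integral_const_mul, ih l hks fun z x => hk1 _ x]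
    · intro l _
      exact (integrable_of_abs_le (measurable_backSmooth_right l hks) (c := 1) fun x =>
        abs_backSmooth_le_const l zero_le_one fun z => hk1 _ x).const_mul _

lemma integral_MG (t : ℕ) (x : X) (f : X → ℝ) :
    ∫ x', f x' ∂H.MG t x = ∫ x', ((H.m x x' : ℝ) * H.g t x') * f x' ∂H.ν := by
  have hmg : Measurable fun x' => H.m x x' * H.g t x' :=
    (H.measurable_m_left x).mul (H.measurable_g t)
  have : H.MG t x = H.ν.withDensity (fun x' => ((H.m x x' * H.g t x' : ℝ≥0) : ℝ≥0∞)) := by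
    rw [MG_apply]; simp
  rw [this, integral_withDensity_eq_integral_smul hmg]
  simp [NNReal.smul_def]

lemma integrable_m_mul {t : ℕ} {K : ℝ≥0} (hK : ∀ x, H.g t x ≤ K) (x : X) {f : X → ℝ}
    (hf : Measurable f) {c : ℝ} (hc : ∀ x, |f x| ≤ c) :
    Integrable (fun x' => ((H.m x x' : ℝ) * H.g t x') * f x') H.ν := by
  have hmg : Measurable fun x' => H.m x x' * H.g t x' :=
    (H.measurable_m_left x).mul (H.measurable_g t)
  have e : H.MG t x = H.ν.withDensity (fun x' => ((H.m x x' * H.g t x' : ℝ≥0) : ℝ≥0∞)) := by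
    rw [MG_apply]; simp
  have := isFiniteKernel_MG hK
  have hi : Integrable f (H.MG t x) := integrable_of_abs_le hf hc
  rw [e, integrable_withDensity_iff_integrable_smul hmg] at hi
  simpa [NNReal.smul_def] using hi

/-- Time reversal: integrating the backward step against the one-step predictive law of the
weighted cloud gives the forward step of the smoothing estimator. -/
lemma sum_integral_backStep {t : ℕ} {K : ℝ≥0} (hK : ∀ x, H.g (t + 1) x ≤ K)
    {k : (Fin (t + 2) → X) → ℝ} (hk : Measurable k) (hk1 : ∀ z, |k z| ≤ 1) :
    ∑ l, ((d t l).2 : ℝ) * ∫ x, H.backStep d t x k ∂H.MG (t + 1) (d t l).1 =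
      H.unnormEst d t (H.fwd t k) := by
  have := isFiniteKernel_MG hK
  have hks : Measurable (Function.uncurry fun (z : Fin (t + 1) → X) x => k (Fin.snoc z x)) :=
    hk.comp measurable_snoc
  have hbs : Measurable fun x => H.backStep d t x k :=
    measurable_backStep measurable_const measurable_id hk
  have hbl : ∀ l, Measurable fun x => H.backSmooth d t l (fun z => k (Fin.snoc z x)) :=
    fun l => measurable_backSmooth_right l hks
  have hR : H.unnormEst d t (H.fwd t k) = ∑ l, ((d t l).2 : ℝ) *
      ∫ x, H.backSmooth d t l (fun z => k (Fin.snoc z x)) ∂H.MG (t + 1) (d t l).1 := by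
    refine Finset.sum_congr rfl fun l _ => ?_
    rw [← backSmooth_integral l hks fun z x => hk1 _]
    congr 1
    exact backSmooth_congr_last l fun z hz => by simp only [fwd, hz]
  rw [hR]
  simp only [integral_MG, ← integral_const_mul]
  rw [← integral_finsetSum, ← integral_finsetSum]
  · congr 1
    funext x
    -- The predictive mixture has exactly the backward denominator as its density factor. Where that
    -- sum vanishes, all its nonnegative terms do, so the identity survives division by zero.
    have hnum : ∑ l, ((d t l).2 : ℝ) * H.m (d t l).1 x * H.backSmooth d t l
        (fun z => k (Fin.snoc z x)) = (∑ l, ((d t l).2 : ℝ) * H.m (d t l).1 x) *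
          H.backStep d t x k := by
      rcases eq_or_ne (∑ l, ((d t l).2 : ℝ) * H.m (d t l).1 x) 0 with h0 | h0
      · rw [h0, zero_mul]
        refine Finset.sum_eq_zero fun l _ => ?_
        rw [(Finset.sum_eq_zero_iff_of_nonneg fun l _ => by positivity).1 h0 l
          (Finset.mem_univ l), zero_mul]
      · rw [backStep, mul_div_cancel₀ _ h0]
    have h1 : ∀ l, ((d t l).2 : ℝ) * ((H.m (d t l).1 x * H.g (t + 1) x) * H.backStep d t x k) =
        H.g (t + 1) x * (((d t l).2 : ℝ) * H.m (d t l).1 x * H.backStep d t x k) :=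
      fun l => by ring
    have h2 : ∀ l, ((d t l).2 : ℝ) * ((H.m (d t l).1 x * H.g (t + 1) x) *
        H.backSmooth d t l (fun z => k (Fin.snoc z x))) = H.g (t + 1) x *
          (((d t l).2 : ℝ) * H.m (d t l).1 x * H.backSmooth d t l (fun z => k (Fin.snoc z x))) :=
      fun l => by ring
    simp only [h1, h2, ← Finset.mul_sum, hnum, ← Finset.sum_mul]
  · exact fun l _ => (integrable_m_mul hK _ (hbl l) fun x =>
      abs_backSmooth_le_const l zero_le_one fun z => hk1 _).const_mul _
  · exact fun l _ => (integrable_m_mul hK _ hbs fun x =>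
      abs_backStep_le_const x zero_le_one hk1).const_mul _

end HMM

/-! ### Importance weights and the instrumental law -/

namespace Proposal

variable {X Y : Type*} [MeasurableSpace X] [MeasurableSpace Y] {H : HMM X Y} (Q : Proposal H)
  {N : ℕ}

lemma measurable_r_left (t : ℕ) (x : X) : Measurable (Q.r t x) :=
  (Q.measurable_r t).comp measurable_prodMk_left

instance (t : ℕ) (x : X) : IsProbabilityMeasure (Q.R t x) :=
  ⟨by simp [R, Q.lintegral_r]⟩

lemma measurable_R (t : ℕ) : Measurable (Q.R t) := by
  have hr : Measurable (Function.uncurry fun x x' => (Q.r t x x' : ℝ≥0∞)) :=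
    (Q.measurable_r t).coe_nnreal_ennreal
  have e : Q.R t = Kernel.withDensity (Kernel.const X H.ν) fun x x' => (Q.r t x x' : ℝ≥0∞) := by
    funext x
    simp [R, Kernel.withDensity_apply _ hr]
  rw [e]
  exact Kernel.measurable _

lemma measurable_w (t : ℕ) : Measurable (Function.uncurry (Q.w t)) :=
  (H.measurable_m.mul ((H.measurable_g t).comp measurable_snd)).div
    (((Q.measurable_ϑ t).comp measurable_fst).mul (Q.measurable_r t))

lemma measurable_w₀ : Measurable Q.w₀ :=
  (Measure.measurable_rnDeriv _ _).ennreal_toNNReal.mul (H.measurable_g 0)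

/-- Domination of `M(x, ·)` by the proposal forces `m(x, ·)` to vanish almost everywhere on `r = 0`,
where the weight is `0` by convention; elsewhere the quotient cancels because `ϑ > 0`. -/
lemma ae_weight_eq (t : ℕ) (x : X) :
    ∀ᵐ x' ∂H.ν, Q.ϑ t x * Q.r t x x' * Q.w t x x' = H.m x x' * H.g t x' := by
  have hr : Measurable fun x' => (Q.r t x x' : ℝ≥0∞) :=
    (Q.measurable_r_left t x).coe_nnreal_ennreal
  have hs : MeasurableSet {x' | (Q.r t x x' : ℝ≥0∞) = 0} := hr (measurableSet_singleton 0)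
  have h1 : H.M x {x' | (Q.r t x x' : ℝ≥0∞) = 0} = 0 := by
    refine Q.M_ac t x ?_
    rw [withDensity_apply_eq_zero hr]
    convert measure_empty (μ := H.ν)
    ext; simp
  rw [H.M_apply, withDensity_apply_eq_zero (H.measurable_m_left x).coe_nnreal_ennreal] at h1
  have h2 : ∀ᵐ x' ∂H.ν, ¬ (H.m x x' ≠ 0 ∧ Q.r t x x' = 0) := by
    rw [ae_iff]
    convert h1 using 2
    ext; simp
  filter_upwards [h2] with x' hx'
  have hϑ := (Q.ϑ_pos t x).ne'
  rcases eq_or_ne (Q.r t x x') 0 with h0 | h0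
  · have : H.m x x' = 0 := by tauto
    simp [h0, this]
  · rw [w, mul_div_cancel₀]
    positivity

lemma integral_weight (t : ℕ) (x : X) (f : X → ℝ) :
    (Q.ϑ t x : ℝ) * ∫ x', (Q.w t x x' : ℝ) * f x' ∂Q.R t x = ∫ x', f x' ∂H.MG t x := by
  rw [HMM.integral_MG, R, integral_withDensity_eq_integral_smul (Q.measurable_r_left t x),
    ← integral_const_mul]
  refine integral_congr_ae ?_
  filter_upwards [Q.ae_weight_eq t x] with x' hx'
  have : (Q.ϑ t x : ℝ) * Q.r t x x' * Q.w t x x' = H.m x x' * H.g t x' := by exact_mod_cast hx'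
  rw [← this, NNReal.smul_def, smul_eq_mul]
  ring

/-- The kernel `M g` is `ϑ ω R` with `R` of mass one. Keeping the factor `ϑ` in the bound is what
later controls `est (fwd k) / est ϑ` without a lower bound on `ϑ`. -/
lemma MG_univ_le_mul {t : ℕ} {K : ℝ≥0} (hK : ∀ x x', Q.w t x x' ≤ K) (x : X) :
    H.MG t x Set.univ ≤ K * Q.ϑ t x := by
  have hr : Measurable fun x' => (Q.r t x x' : ℝ≥0∞) :=
    (Q.measurable_r_left t x).coe_nnreal_ennreal
  rw [H.MG_apply, withDensity_apply _ .univ, Measure.restrict_univ]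
  calc ∫⁻ x', (H.m x x' : ℝ≥0∞) * H.g t x' ∂H.ν
      ≤ ∫⁻ x', (K * Q.ϑ t x : ℝ≥0∞) * Q.r t x x' ∂H.ν := by
        refine lintegral_mono_ae ?_
        filter_upwards [Q.ae_weight_eq t x] with x' hx'
        rw [← ENNReal.coe_mul, ← hx']
        have : Q.ϑ t x * Q.r t x x' * Q.w t x x' ≤ K * Q.ϑ t x * Q.r t x x' := by
          calc _ ≤ Q.ϑ t x * Q.r t x x' * K := by gcongr; exact hK x x'
            _ = _ := by ring
        exact_mod_cast this
    _ = K * Q.ϑ t x := by rw [lintegral_const_mul _ hr, Q.lintegral_r, mul_one]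

lemma abs_fwd_le_mul {t : ℕ} {K K' : ℝ≥0} (hK : ∀ x x', Q.w (t + 1) x x' ≤ K)
    (hK' : ∀ x, H.g (t + 1) x ≤ K')
    {k : (Fin (t + 2) → X) → ℝ} (hk : ∀ z, |k z| ≤ 1) (z : Fin (t + 1) → X) :
    |H.fwd t k z| ≤ K * Q.ϑ (t + 1) (z (Fin.last t)) := by
  have := HMM.isFiniteKernel_MG hK'
  refine (norm_integral_le_of_norm_le_const (f := fun x => k (Fin.snoc z x))
    (C := 1) (ae_of_all _ fun x => hk _)).trans ?_
  rw [one_mul, measureReal_def]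
  have := Q.MG_univ_le_mul hK (z (Fin.last t))
  rw [← ENNReal.coe_mul] at this
  exact_mod_cast ENNReal.toReal_le_coe_of_le_coe this

lemma measurable_instr (t : ℕ) : Measurable fun p : (Fin N → X) × (Fin N → ℝ≥0) =>
    Q.instr t p.1 p.2 := by
  have hc : ∀ i : Fin N, Measurable fun p : (Fin N → X) × (Fin N → ℝ≥0) =>
      (p.2 i : ℝ≥0∞) * Q.ϑ t (p.1 i) := fun i =>
    ((measurable_pi_apply i).comp measurable_snd).coe_nnreal_ennreal.mul
      ((Q.measurable_ϑ t).comp ((measurable_pi_apply i).comp measurable_fst)).coe_nnreal_ennreal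
  refine Measure.measurable_of_measurable_coe _ fun A hA => ?_
  simp only [instr, Measure.smul_apply, Measure.finsetSum_apply, smul_eq_mul]
  refine (Finset.measurable_sum _ fun i _ => hc i).inv.mul
    (Finset.measurable_sum _ fun i _ => (hc i).mul ?_)
  simp only [Measure.map_apply measurable_prodMk_left hA]
  exact (Measure.measurable_coe (measurable_prodMk_left hA)).comp
    ((Q.measurable_R t).comp ((measurable_pi_apply i).comp measurable_fst))

lemma sum_mul_ϑ_pos (t : ℕ) (x : Fin N → X) {ω : Fin N → ℝ≥0} (hω : 0 < ∑ i, ω i) :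
    0 < ∑ i, ω i * Q.ϑ t (x i) := by
  obtain ⟨i, -, hi⟩ := Finset.exists_ne_zero_of_sum_ne_zero hω.ne'
  exact Finset.sum_pos' (fun _ _ => zero_le)
    ⟨i, Finset.mem_univ i, mul_pos (pos_iff_ne_zero.2 hi) (Q.ϑ_pos t _)⟩

lemma isProbabilityMeasure_instr (t : ℕ) (x : Fin N → X) {ω : Fin N → ℝ≥0}
    (hω : 0 < ∑ i, ω i) : IsProbabilityMeasure (Q.instr t x ω) := by
  have h0 := Q.sum_mul_ϑ_pos t x hω
  have e : ∑ i, (ω i * Q.ϑ t (x i) : ℝ≥0∞) = ((∑ i, ω i * Q.ϑ t (x i) : ℝ≥0) : ℝ≥0∞) := by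
    push_cast; rfl
  refine ⟨?_⟩
  simp only [instr, Measure.smul_apply, Measure.finsetSum_apply, smul_eq_mul,
    Measure.map_apply measurable_prodMk_left MeasurableSet.univ, Set.preimage_univ, measure_univ,
    mul_one]
  rw [e]
  exact ENNReal.inv_mul_cancel (by exact_mod_cast h0.ne') ENNReal.coe_ne_top

lemma integral_instr (t : ℕ) (x : Fin N → X) (ω : Fin N → ℝ≥0) {f : Fin N × X → ℝ}
    (hf : Measurable f) {c : ℝ} (hc : ∀ p, |f p| ≤ c) :
    ∫ p, f p ∂Q.instr t x ω = (∑ i, (ω i : ℝ) * Q.ϑ t (x i))⁻¹ *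
      ∑ i, (ω i : ℝ) * Q.ϑ t (x i) * ∫ x', f (i, x') ∂Q.R t (x i) := by
  have e : ∑ i, (ω i * Q.ϑ t (x i) : ℝ≥0∞) = ((∑ i, ω i * Q.ϑ t (x i) : ℝ≥0) : ℝ≥0∞) := by
    push_cast; rfl
  rw [instr, integral_smul_measure, integral_finsetSum_measure]
  · rw [e, ENNReal.toReal_inv, ENNReal.coe_toReal, smul_eq_mul]
    push_cast
    congr 1
    refine Finset.sum_congr rfl fun i _ => ?_
    rw [integral_smul_measure, integral_map measurable_prodMk_left.aemeasurable
      hf.aestronglyMeasurable]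
    simp
  · intro i _
    have := Measure.isProbabilityMeasure_map (μ := Q.R t (x i))
      (measurable_prodMk_left (x := i)).aemeasurable
    exact (HMM.integrable_of_abs_le hf hc).smul_measure
      (ENNReal.mul_ne_top ENNReal.coe_ne_top ENNReal.coe_ne_top)

/-- The conditional mean of a weighted, backward-smoothed function of a new particle. -/
lemma integral_instr_backStep {t : ℕ} {K K' : ℝ≥0} (hK : ∀ x x', Q.w (t + 1) x x' ≤ K)
    (hK' : ∀ x, H.g (t + 1) x ≤ K') {d : ℕ → Fin N → X × ℝ≥0} (hd : H.Reachable d t)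
    (hpos : 0 < ∑ i, (d t i).2) {k : (Fin (t + 2) → X) → ℝ} (hk : Measurable k)
    (hk1 : ∀ z, |k z| ≤ 1) :
    ∫ p : Fin N × X, (Q.w (t + 1) (d t p.1).1 p.2 : ℝ) * H.backStep d t p.2 k
        ∂Q.instr (t + 1) (fun i => (d t i).1) (fun i => (d t i).2) =
      H.est d t (H.fwd t k) / H.est d t (fun z => Q.ϑ (t + 1) (z (Fin.last t))) := by
  have hm : Measurable fun p : Fin N × X =>
      (Q.w (t + 1) (d t p.1).1 p.2 : ℝ) * H.backStep d t p.2 k := by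
    refine Measurable.mul ?_ (HMM.measurable_backStep measurable_const measurable_snd hk)
    exact ((Q.measurable_w (t + 1)).comp (((measurable_of_countable
      fun i => (d t i).1).comp measurable_fst).prodMk measurable_snd)).coe_nnreal_real
  rw [Q.integral_instr _ _ _ hm (c := K * 1) fun p => by
    rw [abs_mul, abs_of_nonneg (by positivity)]
    gcongr
    · exact_mod_cast hK _ _
    · exact HMM.abs_backStep_le_const _ zero_le_one hk1]
  have hpos' : (∑ i, ((d t i).2 : ℝ)) ≠ 0 := by exact_mod_cast hpos.ne'
  -- The total weight cancels between the two estimators. Reachability identifies the denominator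
  -- with the normalizer of the instrumental law, and time reversal identifies the numerator.
  rw [HMM.est, HMM.est, div_div_div_cancel_right₀ hpos',
    hd.unnormEst_last (fun x => (Q.ϑ (t + 1) x : ℝ)), ← HMM.sum_integral_backStep hK' hk hk1,
    div_eq_inv_mul]
  simp only [mul_assoc, Q.integral_weight]

end Proposal

/-! ### Conditional law of a new generation -/

lemma measureReal_le_add_of_ae {Ω : Type*} [MeasurableSpace Ω] {P : Measure Ω} [IsFiniteMeasure P]
    {A B C : Set Ω} (h : ∀ᵐ ω ∂P, ω ∈ A → ω ∈ B ∨ ω ∈ C) : P.real A ≤ P.real B + P.real C := by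
  refine le_trans ?_ (measureReal_union_le B C)
  exact ENNReal.toReal_mono (measure_ne_top _ _) (measure_mono_ae h)

namespace ParticleSystem

variable {X Y : Type*} [MeasurableSpace X] [MeasurableSpace Y] {H : HMM X Y} {Q : Proposal H}
  {T N : ℕ} {Ω : Type*} [MeasurableSpace Ω] {P : Measure Ω} (S : ParticleSystem Q T N P)

/-- The event that the total weight is positive at all times `s < t`. -/
def aliveBefore (t : ℕ) : Set Ω := {ω | ∀ s < t, 0 < ∑ i, S.weight s i ω}

lemma alive_eq : S.alive = S.aliveBefore (T + 1) := by
  ext ω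
  simp only [alive, aliveBefore, Set.mem_ofPred_eq, Nat.lt_succ_iff]

lemma aliveBefore_anti {s t : ℕ} (hst : s ≤ t) : S.aliveBefore t ⊆ S.aliveBefore s :=
  fun _ hω u hu => hω u (hu.trans_le hst)

lemma measurable_weight (s : ℕ) (i : Fin N) : Measurable (S.weight s i) := by
  cases s with
  | zero => exact Q.measurable_w₀.comp (S.measurable_ξ 0 i)
  | succ s =>
    have h1 : Measurable fun p : Fin N × Ω => S.ξ s p.1 p.2 :=
      measurable_from_prod_countable_right fun j => S.measurable_ξ s j
    exact (Q.measurable_w (s + 1)).comp ((h1.comp ((S.measurable_I (s + 1) i).prodMk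
      measurable_id)).prodMk (S.measurable_ξ (s + 1) i))

/-- The weighted cloud, stopped at time `t`. -/
noncomputable def past (t : ℕ) (ω : Ω) (s : ℕ) (i : Fin N) : X × ℝ≥0 := S.cloud ω (min s t) i

lemma past_of_le {s t : ℕ} (hst : s ≤ t) (ω : Ω) : S.past t ω s = S.cloud ω s := by
  funext i
  simp [past, min_eq_left hst]

/-- The information in the particles and weights up to time `t`. -/
noncomputable abbrev history (t : ℕ) : MeasurableSpace Ω :=
  ⨆ s ≤ t, ⨆ i, MeasurableSpace.comap
      (fun ω => (S.ξ s i ω, Q.wt (fun s i => S.ξ s i ω) (fun s i => S.I s i ω) s i))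
        inferInstance

/-- Stopping the cloud at `t` makes the whole sequence measurable for the conditioning σ-algebra, so
it can serve as the variable `V` of `conditional_hoeffding`. -/
lemma measurable_past_history (t : ℕ) : Measurable[S.history t] (S.past t) := by
  refine @measurable_pi_lambda _ _ _ (S.history t) _ _ fun s => ?_
  refine @measurable_pi_lambda _ _ _ (S.history t) _ _ fun i => ?_
  refine Measurable.mono (comap_measurable _) ?_ le_rfl
  exact le_iSup₂_of_le (min s t) (min_le_right s t) (le_iSup_of_le i le_rfl)

lemma measurable_past (t : ℕ) : Measurable (S.past t) :=
  measurable_pi_lambda _ fun _ => measurable_pi_lambda _ fun _ =>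
    (S.measurable_ξ _ _).prodMk (S.measurable_weight _ _)

/-- The clouds with positive total weight at all times `s ≤ t`. -/
def aliveClouds (X : Type*) (N t : ℕ) : Set (ℕ → Fin N → X × ℝ≥0) :=
  {d | ∀ s ≤ t, 0 < ∑ i, (d s i).2}

lemma measurableSet_aliveClouds (t : ℕ) : MeasurableSet (aliveClouds X N t) := by
  have : aliveClouds X N t = ⋂ s ∈ Set.Iic t, {d | 0 < ∑ i, (d s i).2} := by
    ext d; simp [aliveClouds]
  rw [this]
  refine MeasurableSet.biInter (Set.to_countable _) fun s _ => ?_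
  exact measurableSet_lt measurable_const (by fun_prop)

lemma past_preimage_aliveClouds (t : ℕ) :
    S.past t ⁻¹' aliveClouds X N t = S.aliveBefore (t + 1) := by
  ext ω
  simp only [aliveClouds, aliveBefore, Set.mem_preimage, Set.mem_ofPred_eq, Nat.lt_succ_iff]
  refine forall₂_congr fun s hs => ?_
  rw [S.past_of_le hs]; rfl

lemma law_past {t : ℕ} (ht : t < T) {E : Set (ℕ → Fin N → X × ℝ≥0)} (hE : MeasurableSet E)
    (hEG : E ⊆ aliveClouds X N t) {A : Fin N → Set (Fin N × X)}
    (hA : ∀ i, MeasurableSet (A i)) :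
    P (S.past t ⁻¹' E ∩ {ω | ∀ i, (S.I (t + 1) i ω, S.ξ (t + 1) i ω) ∈ A i}) =
      ∫⁻ ω in S.past t ⁻¹' E, ∏ i, Q.instr (t + 1) (fun i => (S.past t ω t i).1)
        (fun i => (S.past t ω t i).2) (A i) ∂P := by
  have h := S.law_step t ht (S.past t ⁻¹' E) (S.measurable_past_history t hE) ?_ A hA
  · rw [h]
    simp only [S.past_of_le le_rfl]
    rfl
  · intro ω hω s hs
    have := hEG hω s hs
    rwa [S.past_of_le hs] at this

lemma weight_succ (s : ℕ) (i : Fin N) (ω : Ω) :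
    S.weight (s + 1) i ω = Q.w (s + 1) (S.ξ s (S.I (s + 1) i ω) ω) (S.ξ (s + 1) i ω) := rfl

/-- The instrumental law gives no mass to an index of zero weight, and there are finitely many
indices. -/
lemma ae_ancestor_weight_pos {t : ℕ} (ht : t < T) (i : Fin N) :
    ∀ᵐ ω ∂P, ω ∈ S.aliveBefore (t + 1) → 0 < S.weight t (S.I (t + 1) i ω) ω := by
  classical
  have key : ∀ j, ∀ᵐ ω ∂P, ¬ (ω ∈ S.aliveBefore (t + 1) ∧ S.weight t j ω = 0 ∧
      S.I (t + 1) i ω = j) := by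
    intro j
    set E : Set (ℕ → Fin N → X × ℝ≥0) := aliveClouds X N t ∩ {d | (d t j).2 = 0}
    have hE : MeasurableSet E := (measurableSet_aliveClouds t).inter
      (measurableSet_eq_fun (by fun_prop) measurable_const)
    -- Only the `i`-th pair is constrained; on `E` its factor in the product is zero.
    have h := S.law_past ht hE Set.inter_subset_left
      (A := fun i' => if i' = i then {j} ×ˢ Set.univ else Set.univ) (fun i' => by
        split_ifs
        · exact (measurableSet_singleton j).prod .univ
        · exact .univ)
    have h0 : ∫⁻ ω in S.past t ⁻¹' E, ∏ i', Q.instr (t + 1) (fun i => (S.past t ω t i).1)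
        (fun i => (S.past t ω t i).2)
          (if i' = i then {j} ×ˢ Set.univ else Set.univ) ∂P = 0 := by
      rw [setLIntegral_congr_fun (g := fun _ => 0) (S.measurable_past t hE), lintegral_zero]
      intro ω hω
      refine Finset.prod_eq_zero (Finset.mem_univ i) ?_
      simp only [if_true, Proposal.instr, Measure.smul_apply, Measure.finsetSum_apply, smul_eq_mul]
      refine mul_eq_zero_of_right _ (Finset.sum_eq_zero fun l _ => ?_)
      rcases eq_or_ne l j with rfl | hl
      · have : (S.past t ω t l).2 = 0 := hω.2
        simp [this]
      · rw [Measure.map_apply measurable_prodMk_left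
          ((measurableSet_singleton j).prod .univ)]
        have : Prod.mk l ⁻¹' ({j} ×ˢ (Set.univ : Set X)) = ∅ := by ext; simp [hl]
        simp [this]
    rw [h0] at h
    rw [ae_iff]
    refine measure_mono_null ?_ h
    intro ω hω
    simp only [Set.mem_ofPred_eq, not_not] at hω
    refine ⟨⟨?_, ?_⟩, ?_⟩
    · change ω ∈ S.past t ⁻¹' aliveClouds X N t
      rw [S.past_preimage_aliveClouds]; exact hω.1
    · change (S.past t ω t j).2 = 0
      rw [S.past_of_le le_rfl]; exact hω.2.1
    · intro i'
      split_ifs with hi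
      · subst hi; simp [hω.2.2]
      · trivial
  filter_upwards [ae_all_iff.2 key] with ω hω hal
  rw [pos_iff_ne_zero]
  exact fun h0 => hω _ ⟨hal, h0, rfl⟩

/-- A positive weight contains the factor `m(ancestor, particle)`, and the ancestor's weight is
almost surely positive; the ancestor's term alone makes the backward denominator positive. -/
lemma ae_reachable : ∀ᵐ ω ∂P, ∀ t ≤ T, ω ∈ S.aliveBefore t → H.Reachable (S.cloud ω) t := by
  have : ∀ t : ℕ, ∀ i, ∀ᵐ ω ∂P, t < T → ω ∈ S.aliveBefore (t + 1) →
      0 < S.weight t (S.I (t + 1) i ω) ω := by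
    intro t i
    by_cases ht : t < T
    · filter_upwards [S.ae_ancestor_weight_pos ht i] with ω hω _ using hω
    · exact ae_of_all _ fun ω h => absurd h ht
  filter_upwards [ae_all_iff.2 fun t => ae_all_iff.2 fun i => this t i] with ω hω t ht hal s hs i hi
  have h1 := hω s i (hs.trans_le ht) (S.aliveBefore_anti hs hal)
  refine Finset.sum_pos' (fun l _ => by positivity) ⟨S.I (s + 1) i ω, Finset.mem_univ _, ?_⟩
  refine mul_pos (by exact_mod_cast h1) ?_
  have h2 : 0 < S.weight (s + 1) i ω := hi
  rw [weight_succ, Proposal.w] at h2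
  have : H.m (S.ξ s (S.I (s + 1) i ω) ω) (S.ξ (s + 1) i ω) ≠ 0 := by
    intro h0; simp [h0] at h2
  exact_mod_cast pos_iff_ne_zero.2 this

/-- Deviation of the weighted sums at time `t + 1` from their conditional mean. -/
lemma unnormEst_succ_deviation [IsProbabilityMeasure P] {t : ℕ} (ht : t < T) (hN : 1 ≤ N) {K K' : ℝ≥0}
    (hK0 : 0 < K) (hK : ∀ x x', Q.w (t + 1) x x' ≤ K) (hK' : ∀ x, H.g (t + 1) x ≤ K')
    {k : (Fin (t + 2) → X) → ℝ} (hk : Measurable k) (hk1 : ∀ z, |k z| ≤ 1) {ε : ℝ} (hε : 0 < ε) :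
    P.real (S.aliveBefore (t + 1) ∩ {ω | ε ≤ |(N : ℝ)⁻¹ * H.unnormEst (S.cloud ω) (t + 1) k -
      H.est (S.cloud ω) t (H.fwd t k) /
        H.est (S.cloud ω) t (fun z => Q.ϑ (t + 1) (z (Fin.last t)))|}) ≤
      2 * Real.exp (-(N * ε ^ 2 / (2 * (K : ℝ) ^ 2))) := by
  obtain ⟨x₀⟩ : Nonempty X := nonempty_of_isProbabilityMeasure H.χ
  have : Nonempty (Fin N × X) := ⟨⟨⟨0, hN⟩, x₀⟩⟩
  let f : (ℕ → Fin N → X × ℝ≥0) → Fin N × X → ℝ := fun d p =>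
    (Q.w (t + 1) (d t p.1).1 p.2 : ℝ) * H.backStep d t p.2 k
  have hf : Measurable (Function.uncurry f) := by
    have h1 : Measurable fun q : (ℕ → Fin N → X × ℝ≥0) × (Fin N × X) => (q.1 t q.2.1).1 := by
      have : Measurable fun r : Fin N × (ℕ → Fin N → X × ℝ≥0) => (r.2 t r.1).1 :=
        measurable_from_prod_countable_right fun j => by dsimp only; fun_prop
      exact this.comp ((measurable_fst.comp measurable_snd).prodMk measurable_fst)
    exact ((Q.measurable_w (t + 1)).comp (h1.prodMk
      (measurable_snd.comp measurable_snd))).coe_nnreal_real.mul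
      (HMM.measurable_backStep measurable_fst (measurable_snd.comp measurable_snd) hk)
  have h := conditional_hoeffding (P := P) hN (S.measurable_past t)
    (ζ := fun i ω => (S.I (t + 1) i ω, S.ξ (t + 1) i ω))
    (fun i => (S.measurable_I _ i).prodMk (S.measurable_ξ _ i)) (measurableSet_aliveClouds t)
    (κ := fun d => Q.instr (t + 1) (fun i => (d t i).1) (fun i => (d t i).2))
    ((Q.measurable_instr (t + 1)).comp (f := fun d : ℕ → Fin N → X × ℝ≥0 =>
      ((fun i => (d t i).1), fun i => (d t i).2)) (by fun_prop))
    (fun d hd => Q.isProbabilityMeasure_instr _ _ (hd t le_rfl))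
    (fun E hE hEG A hA => S.law_past ht hE hEG hA) hf (K := K) (by exact_mod_cast hK0)
    (fun d _ => ae_of_all _ fun p => by
      rw [abs_mul, abs_of_nonneg (by positivity), ← mul_one (K : ℝ)]
      gcongr
      · exact_mod_cast hK _ _
      · exact HMM.abs_backStep_le_const _ zero_le_one hk1) hε
  refine le_trans ?_ h
  refine ENNReal.toReal_mono (measure_ne_top _ _) (measure_mono_ae ?_)
  filter_upwards [S.ae_reachable] with ω hω
  rintro ⟨hal, hdev⟩
  have hreach := hω t ht.le (S.aliveBefore_anti (Nat.le_succ t) hal)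
  refine ⟨by rw [past_preimage_aliveClouds]; exact hal, ?_⟩
  have hcongr : ∀ s ≤ t, S.past t ω s = S.cloud ω s := fun s hs => S.past_of_le hs ω
  have hreach' : H.Reachable (S.past t ω) t := by
    intro s hs i
    rw [hcongr s hs.le, hcongr (s + 1) hs]
    exact hreach s hs i
  have hpos : 0 < ∑ i, (S.past t ω t i).2 := by
    rw [hcongr t le_rfl]; exact hal t (Nat.lt_succ_self t)
  simp only [Set.mem_ofPred_eq] at hdev ⊢
  have hmean : ∫ p, f (S.past t ω) p ∂Q.instr (t + 1) (fun i => (S.past t ω t i).1)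
      (fun i => (S.past t ω t i).2) = H.est (S.cloud ω) t (H.fwd t k) /
        H.est (S.cloud ω) t (fun z => Q.ϑ (t + 1) (z (Fin.last t))) := by
    rw [Q.integral_instr_backStep hK hK' hreach' hpos hk hk1, HMM.est_congr hcongr,
      HMM.est_congr hcongr]
  -- The backward chain from a new particle depends on the new generation through its position only,
  -- so each summand is a function of one pair and the past.
  have hsum : ∑ i, f (S.past t ω) (S.I (t + 1) i ω, S.ξ (t + 1) i ω) =
      H.unnormEst (S.cloud ω) (t + 1) k := by
    refine Finset.sum_congr rfl fun i _ => ?_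
    simp only [f]
    rw [HMM.backStep_congr hcongr, hcongr t le_rfl]
    rfl
  rw [hmean, hsum]
  exact hdev

end ParticleSystem

/-! ### Induction on time: deviations and extinction -/

namespace Proposal

universe u

variable {X Y : Type*} [MeasurableSpace X] [MeasurableSpace Y] {H : HMM X Y}

/-- Exponential deviation inequality for the weighted sums at time `t` around `a`, uniformly over
all runs of the particle filter. -/
def UnnormDeviation (Q : Proposal H) (T t : ℕ) (a : ((Fin (t + 1) → X) → ℝ) → ℝ) : Prop :=
  ∃ B C : ℝ, 0 < B ∧ 0 < C ∧ ∀ (Ω : Type u) [MeasurableSpace Ω] (P : Measure Ω)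
    [IsProbabilityMeasure P] (N : ℕ), 1 ≤ N → ∀ S : ParticleSystem Q T N P,
    ∀ ε : ℝ, 0 < ε → ∀ k : (Fin (t + 1) → X) → ℝ, Measurable k → (∀ z, |k z| ≤ 1) →
      P.real (S.aliveBefore t ∩
        {ω | ε ≤ |(N : ℝ)⁻¹ * H.unnormEst (S.cloud ω) t k - a k|}) ≤
        B * Real.exp (-(C * N * ε ^ 2))

/-- Exponential deviation inequality for the smoothing estimator at time `t`, uniformly over all
runs of the particle filter. -/
def EstDeviation (Q : Proposal H) (T t : ℕ) : Prop :=
  ∃ B C : ℝ, 0 < B ∧ 0 < C ∧ ∀ (Ω : Type u) [MeasurableSpace Ω] (P : Measure Ω)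
    [IsProbabilityMeasure P] (N : ℕ), 1 ≤ N → ∀ S : ParticleSystem Q T N P,
    ∀ ε : ℝ, 0 < ε → ∀ k : (Fin (t + 1) → X) → ℝ, Measurable k → (∀ z, |k z| ≤ 1) →
      P.real (S.aliveBefore (t + 1) ∩
        {ω | ε ≤ |H.est (S.cloud ω) t k - ∫ z, k z ∂H.smooth t|}) ≤
        B * Real.exp (-(C * N * ε ^ 2))

/-- The probability of extinction before time `t` is exponentially small. -/
def ExtinctionBound (Q : Proposal H) (T t : ℕ) : Prop :=
  ∃ B C : ℝ, 0 < B ∧ 0 < C ∧ ∀ (Ω : Type u) [MeasurableSpace Ω] (P : Measure Ω)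
    [IsProbabilityMeasure P] (N : ℕ), 1 ≤ N → ∀ S : ParticleSystem Q T N P,
    P.real (S.aliveBefore t)ᶜ ≤ B * Real.exp (-(C * N))

variable {Q : Proposal H} {T t : ℕ}

/-- The estimator is the quotient of the weighted sums for `k` and for `1`. It is bounded by `1`, so
only the limit `b` of the denominator must be bounded away from zero. -/
lemma UnnormDeviation.estDeviation (ht : t ≤ T) {a : ((Fin (t + 1) → X) → ℝ) → ℝ}
    (h : UnnormDeviation.{u} Q T t a) {b : ℝ} (hb : 0 < b) (h1 : a (fun _ => 1) = b)
    (ha : ∀ k : (Fin (t + 1) → X) → ℝ, Measurable k → (∀ z, |k z| ≤ 1) →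
      ∫ z, k z ∂H.smooth t = a k / b) : EstDeviation.{u} Q T t := by
  obtain ⟨B, C, hB, hC, h⟩ := h
  -- Numerator and denominator may each err by `b ε / 2`; the two events give the factor `2`.
  refine ⟨2 * B, C * (b / 2) ^ 2, by positivity, by positivity, ?_⟩
  intro Ω _ P _ N hN S ε hε k hk hk1
  have hε' : 0 < b / 2 * ε := by positivity
  have hk' := h Ω P N hN S (b / 2 * ε) hε' k hk hk1
  have h1' := h Ω P N hN S (b / 2 * ε) hε' (fun _ => 1) measurable_const (by simp)
  have e : C * N * (b / 2 * ε) ^ 2 = C * (b / 2) ^ 2 * N * ε ^ 2 := by ring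
  rw [e] at hk' h1'
  refine (measureReal_le_add_of_ae ?_).trans ((add_le_add hk' h1').trans (by linarith))
  filter_upwards [S.ae_reachable] with ω hω
  rintro ⟨hal, hdev⟩
  have hal' := S.aliveBefore_anti (Nat.le_succ t) hal
  have hreach := hω t ht hal'
  by_contra hcon
  simp only [Set.mem_inter_iff, hal', true_and, Set.mem_ofPred_eq, not_or, not_le, h1] at hcon hdev
  have hN' : (0 : ℝ) < N := by exact_mod_cast hN
  have hpos : (0 : ℝ) < ∑ i, ((S.cloud ω t i).2 : ℝ) := by
    exact_mod_cast hal t (Nat.lt_succ_self t)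
  have hest : H.est (S.cloud ω) t k = ((N : ℝ)⁻¹ * H.unnormEst (S.cloud ω) t k) /
      ((N : ℝ)⁻¹ * H.unnormEst (S.cloud ω) t fun _ => 1) := by
    rw [hreach.unnormEst_one, HMM.est, mul_div_mul_left _ _ (by positivity)]
  have hbd : |((N : ℝ)⁻¹ * H.unnormEst (S.cloud ω) t k) /
      ((N : ℝ)⁻¹ * H.unnormEst (S.cloud ω) t fun _ => 1)| ≤ 1 := by
    rw [← hest]; exact HMM.abs_est_le_const zero_le_one hk1
  have := abs_div_sub_div_le (a' := a k) (by rw [hreach.unnormEst_one]; positivity) hb hbd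
  rw [← hest, ← ha k hk hk1] at this
  have h3 := hdev.trans this
  rw [le_div_iff₀ hb] at h3
  linarith [hcon.1, hcon.2]

lemma EstDeviation.of_abs_le (h : EstDeviation.{u} Q T t) : ∃ B C : ℝ, 0 < B ∧ 0 < C ∧
    ∀ (Ω : Type u) [MeasurableSpace Ω] (P : Measure Ω)
    [IsProbabilityMeasure P] (N : ℕ), 1 ≤ N → ∀ S : ParticleSystem Q T N P,
    ∀ ε : ℝ, 0 < ε → ∀ k : (Fin (t + 1) → X) → ℝ, Measurable k → ∀ c : ℝ, 0 < c →
      (∀ z, |k z| ≤ c) → P.real (S.aliveBefore (t + 1) ∩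
        {ω | ε ≤ |H.est (S.cloud ω) t k - ∫ z, k z ∂H.smooth t|}) ≤
        B * Real.exp (-(C * N * (ε / c) ^ 2)) := by
  obtain ⟨B, C, hB, hC, h⟩ := h
  refine ⟨B, C, hB, hC, ?_⟩
  intro Ω _ P _ N hN S ε hε k hk c hc hkc
  refine le_trans (le_of_eq ?_) (h Ω P N hN S (ε / c) (by positivity) (fun z => c⁻¹ * k z)
    (hk.const_mul _) fun z => ?_)
  · congr 2
    ext ω
    simp only [Set.mem_ofPred_eq]
    rw [HMM.est_const_mul, integral_const_mul, ← mul_sub, abs_mul, abs_of_pos (inv_pos.2 hc),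
      div_eq_inv_mul, mul_le_mul_iff_right₀ (inv_pos.2 hc)]
  · rw [abs_mul, abs_of_pos (inv_pos.2 hc), inv_mul_le_iff₀ hc, mul_one]
    exact hkc z

/-- The error is split into the fluctuation around the conditional mean, controlled by Hoeffding,
and the error of that mean, a quotient of two estimators at time `t` covered by the hypothesis. -/
lemma EstDeviation.unnormDeviation_succ (ht : t < T) (h : EstDeviation.{u} Q T t)
    (hg : ∀ s ≤ t, ∀ x, 0 < H.g s x) {Kg Kϑ Kw : ℝ≥0} (hKg0 : 0 < Kg) (hKϑ0 : 0 < Kϑ)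
    (hKw0 : 0 < Kw) (hKg : ∀ s ≤ t + 1, ∀ x, H.g s x ≤ Kg) (hKϑ : ∀ x, Q.ϑ (t + 1) x ≤ Kϑ)
    (hKw : ∀ x x', Q.w (t + 1) x x' ≤ Kw) :
    UnnormDeviation.{u} Q T (t + 1) (fun k => (∫ z, H.fwd t k z ∂H.smooth t) /
      ∫ z, (Q.ϑ (t + 1) (z (Fin.last t)) : ℝ) ∂H.smooth t) := by
  have := HMM.isProbabilityMeasure_smooth hg fun s hs => hKg s (hs.trans (Nat.le_succ t))
  obtain ⟨B, C, hB, hC, h⟩ := h.of_abs_le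
  have hϑm : Measurable fun z : Fin (t + 1) → X => (Q.ϑ (t + 1) (z (Fin.last t)) : ℝ) :=
    ((Q.measurable_ϑ (t + 1)).comp (measurable_pi_apply _)).coe_nnreal_real
  have hϑb : ∀ z : Fin (t + 1) → X, |(Q.ϑ (t + 1) (z (Fin.last t)) : ℝ)| ≤ Kϑ := fun z => by
    rw [abs_of_nonneg (by positivity)]; exact_mod_cast hKϑ _
  set θ := ∫ z, (Q.ϑ (t + 1) (z (Fin.last t)) : ℝ) ∂H.smooth t
  have hθ : 0 < θ := HMM.integral_pos_of_pos (HMM.integrable_of_abs_le hϑm hϑb)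
    fun z => by exact_mod_cast Q.ϑ_pos _ _
  have hKg0' : (0 : ℝ) < Kg := by exact_mod_cast hKg0
  have hKϑ0' : (0 : ℝ) < Kϑ := by exact_mod_cast hKϑ0
  have hKw0' : (0 : ℝ) < Kw := by exact_mod_cast hKw0
  -- Allowed errors: `ε / 2` for the fluctuation, `θ ε / 4` for the numerator (bounded by `Kg`), and
  -- `θ ε / (4 Kw)` for the denominator (bounded by `Kϑ`), whose error is multiplied by `Kw` in the
  -- quotient bound.
  set C₁ := 1 / (8 * (Kw : ℝ) ^ 2) with hC₁
  set C₂ := C * (θ / (4 * Kg)) ^ 2 with hC₂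
  set C₃ := C * (θ / (4 * Kw * Kϑ)) ^ 2 with hC₃
  refine ⟨2 + 2 * B, min C₁ (min C₂ C₃), by positivity, by positivity, ?_⟩
  intro Ω _ P _ N hN S ε hε k hk hk1
  have e₁ := S.unnormEst_succ_deviation ht hN hKw0 hKw (hKg _ le_rfl) hk hk1 (half_pos hε)
  have e₂ := h Ω P N hN S (θ * ε / 4) (by positivity) (H.fwd t k) (HMM.measurable_fwd hk) Kg
    hKg0' (HMM.abs_fwd_le (hKg _ le_rfl) hk1)
  have e₃ := h Ω P N hN S (θ * ε / (4 * Kw)) (by positivity) _ hϑm Kϑ hKϑ0' hϑb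
  have m : ∀ {c : ℝ}, min C₁ (min C₂ C₃) ≤ c →
      Real.exp (-(c * N * ε ^ 2)) ≤ Real.exp (-(min C₁ (min C₂ C₃) * N * ε ^ 2)) := by
    intro c hc
    gcongr
  have m₁ := m (min_le_left C₁ _)
  have m₂ := m ((min_le_right C₁ _).trans (min_le_left C₂ C₃))
  have m₃ := m ((min_le_right C₁ _).trans (min_le_right C₂ C₃))
  have r₁ : (N : ℝ) * (ε / 2) ^ 2 / (2 * (Kw : ℝ) ^ 2) = C₁ * N * ε ^ 2 := by
    rw [hC₁]; field_simp; norm_num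
  have r₂ : C * N * (θ * ε / 4 / Kg) ^ 2 = C₂ * N * ε ^ 2 := by
    rw [hC₂]; field_simp
  have r₃ : C * N * (θ * ε / (4 * Kw) / Kϑ) ^ 2 = C₃ * N * ε ^ 2 := by
    rw [hC₃]; field_simp
  rw [r₁] at e₁
  rw [r₂] at e₂
  rw [r₃] at e₃
  have hsplit := measureReal_le_add_of_ae (P := P)
    (A := S.aliveBefore (t + 1) ∩ {ω | ε ≤ |(N : ℝ)⁻¹ * H.unnormEst (S.cloud ω) (t + 1) k -
      (∫ z, H.fwd t k z ∂H.smooth t) / θ|})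
    (B := S.aliveBefore (t + 1) ∩ {ω | ε / 2 ≤ |(N : ℝ)⁻¹ *
      H.unnormEst (S.cloud ω) (t + 1) k - H.est (S.cloud ω) t (H.fwd t k) /
        H.est (S.cloud ω) t (fun z => Q.ϑ (t + 1) (z (Fin.last t)))|})
    (C := (S.aliveBefore (t + 1) ∩ {ω | θ * ε / 4 ≤
        |H.est (S.cloud ω) t (H.fwd t k) - ∫ z, H.fwd t k z ∂H.smooth t|}) ∪
      (S.aliveBefore (t + 1) ∩ {ω | θ * ε / (4 * Kw) ≤
        |H.est (S.cloud ω) t (fun z => Q.ϑ (t + 1) (z (Fin.last t))) - θ|})) ?_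
  · refine hsplit.trans ((add_le_add e₁ ((measureReal_union_le _ _).trans
      (add_le_add e₂ e₃))).trans ?_)
    nlinarith [Real.exp_pos (-(min C₁ (min C₂ C₃) * N * ε ^ 2)),
      mul_le_mul_of_nonneg_left m₂ hB.le, mul_le_mul_of_nonneg_left m₃ hB.le]
  · filter_upwards [S.ae_reachable] with ω hω
    rintro ⟨hal, hdev⟩
    have hreach := hω t ht.le (S.aliveBefore_anti (Nat.le_succ t) hal)
    by_contra hcon
    simp only [Set.mem_inter_iff, Set.mem_union, hal, true_and, Set.mem_ofPred_eq, not_or,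
      not_le] at hcon hdev
    obtain ⟨c₁, c₂, c₃⟩ := hcon
    have hw : 0 < ∑ i, (S.cloud ω t i).2 := hal t (Nat.lt_succ_self t)
    have hpos : 0 < H.est (S.cloud ω) t (fun z => Q.ϑ (t + 1) (z (Fin.last t))) := by
      rw [HMM.est, hreach.unnormEst_last (fun x => (Q.ϑ (t + 1) x : ℝ))]
      refine div_pos ?_ (by exact_mod_cast hw)
      exact_mod_cast Q.sum_mul_ϑ_pos (t + 1) (fun i => (S.cloud ω t i).1) hw
    -- Monotonicity of the estimator applied to `|fwd k| ≤ Kw ϑ`.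
    have hbd : |H.est (S.cloud ω) t (H.fwd t k) /
        H.est (S.cloud ω) t (fun z => Q.ϑ (t + 1) (z (Fin.last t)))| ≤ Kw := by
      rw [abs_div, abs_of_pos hpos, div_le_iff₀ hpos, ← HMM.est_const_mul]
      exact HMM.abs_est_le (Q.abs_fwd_le_mul hKw (hKg _ le_rfl) hk1)
    have h3 := abs_div_sub_div_le (a' := ∫ z, H.fwd t k z ∂H.smooth t) hpos.ne' hθ hbd
    have h4 := abs_sub_le ((N : ℝ)⁻¹ * H.unnormEst (S.cloud ω) (t + 1) k)
      (H.est (S.cloud ω) t (H.fwd t k) /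
        H.est (S.cloud ω) t (fun z => Q.ϑ (t + 1) (z (Fin.last t))))
      ((∫ z, H.fwd t k z ∂H.smooth t) / θ)
    have c₃' : Kw * |H.est (S.cloud ω) t (fun z => Q.ϑ (t + 1) (z (Fin.last t))) - θ| <
        θ * ε / 4 := by
      calc _ < Kw * (θ * ε / (4 * Kw)) := by gcongr
        _ = _ := by field_simp
    have h5 : (|H.est (S.cloud ω) t (H.fwd t k) - ∫ z, H.fwd t k z ∂H.smooth t| +
        Kw * |H.est (S.cloud ω) t (fun z => Q.ϑ (t + 1) (z (Fin.last t))) - θ|) / θ < ε / 2 := by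
      rw [div_lt_iff₀ hθ]
      linarith
    linarith

/-- Plain importance sampling: the density of `χ` with respect to `ρ₀` in the weight turns the mean
under `ρ₀` into a `χ`-integral. -/
lemma unnormDeviation_zero {K : ℝ≥0} (hK0 : 0 < K) (hK : ∀ᵐ x ∂Q.ρ₀, Q.w₀ x ≤ K) :
    UnnormDeviation.{u} Q T 0 (fun k => ∫ x, (H.g 0 x : ℝ) * k (fun _ => x) ∂H.χ) := by
  have hK0' : (0 : ℝ) < K := by exact_mod_cast hK0
  refine ⟨2, 1 / (2 * (K : ℝ) ^ 2), by norm_num, by positivity, ?_⟩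
  intro Ω _ P _ N hN S ε hε k hk hk1
  have hc : Measurable fun (x : X) (_ : Fin 1) => x := by fun_prop
  have hm : Measurable fun x : X => (Q.w₀ x : ℝ) * k (fun _ => x) :=
    Q.measurable_w₀.coe_nnreal_real.mul (hk.comp hc)
  have h := hoeffding_abs_mean (P := P) hN
    (X := fun i ω => (Q.w₀ (S.ξ 0 i ω) : ℝ) * k (fun _ => S.ξ 0 i ω))
    (S.indep_init.comp (fun _ x => (Q.w₀ x : ℝ) * k (fun _ => x)) fun _ => hm)
    (fun i => (hm.comp (S.measurable_ξ 0 i)).aemeasurable) hK0'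
    (fun i => by
      have : ∀ᵐ ω ∂P, Q.w₀ (S.ξ 0 i ω) ≤ K := by
        rw [← S.law_init i] at hK
        exact ae_of_ae_map (S.measurable_ξ 0 i).aemeasurable hK
      filter_upwards [this] with ω hω
      rw [abs_mul, abs_of_nonneg (by positivity), ← mul_one (K : ℝ)]
      gcongr
      exact hk1 _)
    (a := ∫ x, (H.g 0 x : ℝ) * k (fun _ => x) ∂H.χ) (fun i => by
      rw [← integral_rnDeriv_smul Q.χ_ac, ← S.law_init i,
        integral_map (S.measurable_ξ 0 i).aemeasurable]
      · simp only [w₀, S.law_init i, smul_eq_mul]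
        congr 1
        funext ω
        push_cast
        exact mul_assoc _ _ _
      · refine (Measurable.mul ?_ ?_).aestronglyMeasurable
        · exact (Measure.measurable_rnDeriv _ _).ennreal_toReal
        · exact (H.measurable_g 0).coe_nnreal_real.mul (hk.comp hc)) hε
  refine (measureReal_mono Set.inter_subset_right).trans (le_trans h (le_of_eq ?_))
  congr 3
  field_simp

/-- If generation `t` has total weight zero, the weighted sum for `k = 1` is off by its full limit
`b`, so the deviation inequality is used with `ε = b`. -/
lemma UnnormDeviation.extinctionBound_succ (ht : t ≤ T) {a : ((Fin (t + 1) → X) → ℝ) → ℝ}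
    (h : UnnormDeviation.{u} Q T t a) (h1 : 0 < a (fun _ => 1))
    (hext : ExtinctionBound.{u} Q T t) : ExtinctionBound.{u} Q T (t + 1) := by
  obtain ⟨B, C, hB, hC, h⟩ := h
  obtain ⟨B', C', hB', hC', hext⟩ := hext
  set b := a (fun _ => 1)
  refine ⟨B' + B, min C' (C * b ^ 2), by positivity, by positivity, ?_⟩
  intro Ω _ P _ N hN S
  have e₁ := hext Ω P N hN S
  have e₂ := h Ω P N hN S b h1 (fun _ => 1) measurable_const (by simp)
  have m : ∀ {c : ℝ}, min C' (C * b ^ 2) ≤ c →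
      Real.exp (-(c * N)) ≤ Real.exp (-(min C' (C * b ^ 2) * N)) := by
    intro c hc
    gcongr
  have m₁ := mul_le_mul_of_nonneg_left (m (min_le_left C' _)) hB'.le
  have m₂ := mul_le_mul_of_nonneg_left (m (min_le_right C' _)) hB.le
  rw [mul_right_comm C] at e₂
  refine (measureReal_le_add_of_ae ?_).trans ((add_le_add (e₁.trans m₁) (e₂.trans m₂)).trans
    (le_of_eq (add_mul _ _ _).symm))
  filter_upwards [S.ae_reachable] with ω hω hdead
  by_cases hal : ω ∈ S.aliveBefore t
  · refine Or.inr ⟨hal, ?_⟩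
    have hreach := hω t ht hal
    have h0 : ∑ i, S.weight t i ω = 0 := by
      by_contra hne
      refine hdead fun s hs => ?_
      rcases (Nat.lt_succ_iff_lt_or_eq.1 hs) with hs | rfl
      · exact hal s hs
      · exact pos_iff_ne_zero.2 hne
    have h0' : ∑ i, ((S.cloud ω t i).2 : ℝ) = 0 := by exact_mod_cast h0
    simp only [Set.mem_ofPred_eq]
    rw [hreach.unnormEst_one, h0', mul_zero, zero_sub, abs_neg, abs_of_pos h1]
  · exact Or.inl hal

lemma extinctionBound_zero : ExtinctionBound.{u} Q T 0 := by
  refine ⟨1, 1, one_pos, one_pos, fun Ω _ P _ N hN S => ?_⟩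
  have : S.aliveBefore 0 = Set.univ := by ext; simp [ParticleSystem.aliveBefore]
  rw [this]
  simp
  positivity

end Proposal

/-! ### Backward kernels and the functions `F` -/

namespace HMM

variable {X Y : Type*} [MeasurableSpace X] [MeasurableSpace Y] {H : HMM X Y}

instance (t : ℕ) : SFinite (H.filt t) := by unfold filt; infer_instance

lemma isProbabilityMeasure_filt {t : ℕ} (hg : ∀ s ≤ t, ∀ x, 0 < H.g s x) {K : ℝ≥0}
    (hK : ∀ s ≤ t, ∀ x, H.g s x ≤ K) : IsProbabilityMeasure (H.filt t) :=
  have := isProbabilityMeasure_smooth hg hK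
  Measure.isProbabilityMeasure_map (measurable_pi_apply _).aemeasurable

lemma exists_lintegral_filt_succ {t : ℕ} (hg : ∀ s ≤ t + 1, ∀ x, 0 < H.g s x) {K : ℝ≥0}
    (hK : ∀ s ≤ t + 1, ∀ x, H.g s x ≤ K) :
    ∃ c : ℝ≥0∞, c ≠ 0 ∧ c ≠ ∞ ∧ ∀ f : X → ℝ≥0∞, Measurable f →
      ∫⁻ x, f x ∂H.filt (t + 1) = c * ∫⁻ x, ∫⁻ x', f x' ∂H.MG (t + 1) x ∂H.filt t := by
  obtain ⟨c, h0, h1, hc⟩ := exists_smooth_succ hg hK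
  refine ⟨c, h0, h1, fun f hf => ?_⟩
  have hfl : Measurable fun z : Fin (t + 2) → X => f (z (Fin.last (t + 1))) :=
    hf.comp (measurable_pi_apply _)
  have hfs : Measurable fun p : (Fin (t + 1) → X) × X =>
      f ((Fin.snoc p.1 p.2 : Fin (t + 2) → X) (Fin.last (t + 1))) := hfl.comp measurable_snoc
  rw [filt, lintegral_map hf (measurable_pi_apply _), hc, lintegral_smul_measure,
    lintegral_map hfl measurable_snoc, Measure.lintegral_compProd hfs, filt,
    lintegral_map hf.lintegral_kernel (measurable_pi_apply _), smul_eq_mul]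
  simp only [Fin.snoc_last]
  rfl

lemma measurable_lintegral_m (η : Measure X) [SFinite η] :
    Measurable fun x => ∫⁻ z, (H.m z x : ℝ≥0∞) ∂η :=
  Measurable.lintegral_prod_right' (f := fun p : X × X => (H.m p.2 p.1 : ℝ≥0∞))
    (H.measurable_m.comp measurable_swap).coe_nnreal_ennreal

lemma measurable_m_right (H : HMM X Y) (x : X) : Measurable fun z => (H.m z x : ℝ≥0∞) :=
  (H.measurable_m.comp measurable_prodMk_right).coe_nnreal_ennreal

lemma lintegral_backward (η : Measure X) (x : X) {f : X → ℝ≥0∞} (hf : Measurable f) :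
    ∫⁻ z, f z ∂H.backward η x =
      (∫⁻ z, (H.m z x : ℝ≥0∞) ∂η)⁻¹ * ∫⁻ z, (H.m z x : ℝ≥0∞) * f z ∂η := by
  rw [backward, lintegral_smul_measure, smul_eq_mul,
    lintegral_withDensity_eq_lintegral_mul _ (H.measurable_m_right x) hf]
  rfl

lemma backward_univ (η : Measure X) (x : X) :
    H.backward η x Set.univ =
      (∫⁻ z, (H.m z x : ℝ≥0∞) ∂η)⁻¹ * ∫⁻ z, (H.m z x : ℝ≥0∞) ∂η := by
  simpa using lintegral_backward (H := H) η x (f := fun _ => 1) measurable_const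

lemma backward_ac (η : Measure X) (x : X) : H.backward η x ≪ η :=
  (Measure.smul_absolutelyContinuous).trans (withDensity_absolutelyContinuous _ _)

/-- The normalizing constants of the backward kernels are a.s. positive and finite. -/
lemma ae_filt_succ_lintegral_m {t : ℕ} (hg : ∀ s ≤ t + 1, ∀ x, 0 < H.g s x) {K : ℝ≥0}
    (hK : ∀ s ≤ t + 1, ∀ x, H.g s x ≤ K) :
    ∀ᵐ x ∂H.filt (t + 1), ∫⁻ z, (H.m z x : ℝ≥0∞) ∂H.filt t ≠ 0 ∧
      ∫⁻ z, (H.m z x : ℝ≥0∞) ∂H.filt t ≠ ∞ := by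
  have := isProbabilityMeasure_filt (fun s hs => hg s (hs.trans (Nat.le_succ t)))
    (fun s hs => hK s (hs.trans (Nat.le_succ t)))
  obtain ⟨c, -, -, hc⟩ := exists_lintegral_filt_succ hg hK
  set D : X → ℝ≥0∞ := fun x => ∫⁻ z, (H.m z x : ℝ≥0∞) ∂H.filt t
  have hDm : Measurable D := measurable_lintegral_m _
  set A : Set X := {x | ¬ (D x ≠ 0 ∧ D x ≠ ∞)}
  have hA : MeasurableSet A :=
    ((measurableSet_eq_fun hDm measurable_const).compl.inter
      (measurableSet_eq_fun hDm measurable_const).compl).compl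
  -- By Tonelli `D` has `ν`-integral one, since `m(z, ·)` and the filter are normalized.
  have hDfin : ∀ᵐ x ∂H.ν, D x < ∞ := by
    refine ae_lt_top hDm ?_
    rw [lintegral_lintegral_swap (f := fun x z => (H.m z x : ℝ≥0∞))
      (H.measurable_m.comp measurable_swap).coe_nnreal_ennreal.aemeasurable]
    simp [H.lintegral_m]
  have hgA : Measurable fun x => (H.g (t + 1) x : ℝ≥0∞) * A.indicator 1 x :=
    (H.measurable_g (t + 1)).coe_nnreal_ennreal.mul (measurable_one.indicator hA)
  have hi : Measurable (A.indicator (1 : X → ℝ≥0∞)) := measurable_one.indicator hA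
  have key : ∫⁻ x, ∫⁻ x', A.indicator 1 x' ∂H.MG (t + 1) x ∂H.filt t = 0 := by
    have e : ∀ x, ∫⁻ x', A.indicator 1 x' ∂H.MG (t + 1) x =
        ∫⁻ x', (H.m x x' : ℝ≥0∞) * ((H.g (t + 1) x' : ℝ≥0∞) * A.indicator 1 x') ∂H.ν := by
      intro x
      rw [lintegral_MG _ _ hi, M_apply, lintegral_withDensity_eq_lintegral_mul _
        (H.measurable_m_left x).coe_nnreal_ennreal hgA]
      rfl
    simp only [e]
    -- After the swap the integrand is `D g` on the bad set `A`, where `D` is `ν`-almost everywhere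
    -- zero.
    rw [lintegral_lintegral_swap]
    · have e2 : ∀ x', ∫⁻ x, (H.m x x' : ℝ≥0∞) * ((H.g (t + 1) x' : ℝ≥0∞) * A.indicator 1 x')
          ∂H.filt t = D x' * ((H.g (t + 1) x' : ℝ≥0∞) * A.indicator 1 x') := fun x' =>
        lintegral_mul_const _ (H.measurable_m_right x')
      simp only [e2]
      refine (lintegral_eq_zero_iff (hDm.mul hgA)).2 ?_
      filter_upwards [hDfin] with x hx
      by_cases hxA : x ∈ A
      · have : D x = 0 := by
          by_contra h0
          exact hxA ⟨h0, hx.ne⟩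
        simp [this]
      · simp [hxA]
    · exact (H.measurable_m.coe_nnreal_ennreal.mul (hgA.comp measurable_snd)).aemeasurable
  have := hc _ hi
  rw [key, mul_zero, lintegral_indicator_one hA] at this
  exact this

/-- Integrating the backward kernels does not change functions of the remaining coordinates. -/
lemma ae_backwardInt_eq {t : ℕ} (hg : ∀ s ≤ t, ∀ x, 0 < H.g s x) {K : ℝ≥0}
    (hK : ∀ s ≤ t, ∀ x, H.g s x ≤ K) :
    ∀ᵐ x ∂H.filt t, ∀ (f : (ℕ → X) → ℝ≥0∞) (z : ℕ → X), z t = x →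
      (∀ z' : ℕ → X, (∀ s, t ≤ s → z' s = z s) → f z' = f z) → H.backwardInt f t z = f z := by
  induction t with
  | zero => exact ae_of_all _ fun x f z _ _ => rfl
  | succ t ih =>
    have ih := ih (fun s hs => hg s (hs.trans (Nat.le_succ t)))
      (fun s hs => hK s (hs.trans (Nat.le_succ t)))
    filter_upwards [ae_filt_succ_lintegral_m hg hK] with x hx f z hz hf
    subst hz
    -- The exceptional set of the induction hypothesis is `φ_t`-null, hence null for the backward
    -- kernel, which is absolutely continuous with respect to `φ_t`.
    have h1 : ∀ᵐ x' ∂H.backward (H.filt t) (z (t + 1)),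
        H.backwardInt f t (Function.update z t x') = f z := by
      filter_upwards [(backward_ac _ _).ae_le ih] with x' hx'
      have hu : f (Function.update z t x') = f z := hf _ fun s hs =>
        Function.update_of_ne (by omega) _ _
      rw [hx' f _ (Function.update_self _ _ _), hu]
      intro z' hz'
      rw [hu]
      refine hf _ fun s hs => ?_
      rw [hz' s (by omega), Function.update_of_ne (by omega)]
    rw [backwardInt, lintegral_congr_ae h1, lintegral_const, backward_univ,
      ENNReal.inv_mul_cancel hx.1 hx.2, mul_one]

lemma measurable_backwardInt {f : (ℕ → X) → ℝ≥0∞} (hf : Measurable f) (t : ℕ) :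
    Measurable (H.backwardInt f t) := by
  induction t with
  | zero => exact hf
  | succ t ih =>
    have hu : Measurable fun p : (ℕ → X) × X => H.backwardInt f t (Function.update p.1 t p.2) :=
      ih.comp measurable_update'
    have e : H.backwardInt f (t + 1) = fun x => (∫⁻ z, (H.m z (x (t + 1)) : ℝ≥0∞) ∂H.filt t)⁻¹ *
        ∫⁻ z, (H.m z (x (t + 1)) : ℝ≥0∞) * H.backwardInt f t (Function.update x t z)
          ∂H.filt t := by
      funext x
      exact lintegral_backward _ _ (hu.comp measurable_prodMk_left)
    rw [e]
    refine ((measurable_lintegral_m _).comp (measurable_pi_apply (t + 1))).inv.mul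
      (Measurable.lintegral_prod_right' (f := fun p : (ℕ → X) × X =>
        (H.m p.2 (p.1 (t + 1)) : ℝ≥0∞) * H.backwardInt f t (Function.update p.1 t p.2)) ?_)
    exact (H.measurable_m.comp (measurable_snd.prodMk
      ((measurable_pi_apply (t + 1)).comp measurable_fst))).coe_nnreal_ennreal.mul hu

/-- Backward kernels have mass at most one at every point, degenerate denominators included. -/
lemma backwardInt_le {f : (ℕ → X) → ℝ≥0∞} {c : ℝ≥0∞} (hf : ∀ z, f z ≤ c) (t : ℕ) (z : ℕ → X) :
    H.backwardInt f t z ≤ c := by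
  induction t generalizing z with
  | zero => exact hf z
  | succ t ih =>
    rw [backwardInt]
    refine (lintegral_mono fun x' => ih _).trans ?_
    rw [lintegral_const, backward_univ]
    exact mul_le_of_le_one_right' (ENNReal.inv_mul_le_one _)

/-- The total mass of `k` forward steps from `x` at time `t`. -/
noncomputable def fwdMass (H : HMM X Y) : ℕ → ℕ → X → ℝ≥0∞
  | 0, _, _ => 1
  | k + 1, t, x => ∫⁻ x', fwdMass H k (t + 1) x' ∂H.MG (t + 1) x

lemma measurable_fwdMass (k t : ℕ) : Measurable (H.fwdMass k t) := by
  induction k generalizing t with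
  | zero => exact measurable_const
  | succ k ih => exact (ih (t + 1)).lintegral_kernel

lemma forwardInt_one (k t : ℕ) (x : ℕ → X) :
    H.forwardInt (fun _ => 1) k t x = H.fwdMass k t (x t) := by
  induction k generalizing t x with
  | zero => rfl
  | succ k ih =>
    rw [forwardInt, fwdMass, lintegral_MG _ _ (measurable_fwdMass _ _)]
    simp [ih]

lemma fwdMass_le {T : ℕ} {K : ℝ≥0} (hK : ∀ s ≤ T, ∀ x, H.g s x ≤ K) {k t : ℕ} (hkt : t + k ≤ T)
    (x : X) : H.fwdMass k t x ≤ (K : ℝ≥0∞) ^ k := by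
  induction k generalizing t x with
  | zero => simp [fwdMass]
  | succ k ih =>
    rw [fwdMass]
    refine (lintegral_mono fun x' => ih (by omega) x').trans ?_
    rw [lintegral_const, pow_succ]
    gcongr
    exact MG_univ_le (hK (t + 1) (by omega)) x

lemma F_one_eq (t T : ℕ) (x : X) : H.F t T x (fun _ => 1) =
    H.backwardInt (fun z => H.fwdMass (T - t) t (z t)) t (fun _ => x) := by
  simp only [F, L, forwardInt_one]

lemma measurable_F_one (t T : ℕ) : Measurable fun x => H.F t T x (fun _ => 1) := by
  simp only [F_one_eq]
  exact (measurable_backwardInt ((measurable_fwdMass _ _).comp (measurable_pi_apply t)) t).comp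
    (measurable_pi_lambda _ fun _ => measurable_id)

lemma F_one_le {t T : ℕ} (ht : t ≤ T) {K : ℝ≥0} (hK : ∀ s ≤ T, ∀ x, H.g s x ≤ K) (x : X) :
    H.F t T x (fun _ => 1) ≤ (K : ℝ≥0∞) ^ (T - t) := by
  rw [F_one_eq]
  exact backwardInt_le (fun z => fwdMass_le hK (by omega) _) _ _

lemma ae_F_one_eq {t T : ℕ} (ht : t ≤ T) (hg : ∀ s ≤ T, ∀ x, 0 < H.g s x) {K : ℝ≥0}
    (hK : ∀ s ≤ T, ∀ x, H.g s x ≤ K) :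
    ∀ᵐ x ∂H.filt t, H.F t T x (fun _ => 1) = H.fwdMass (T - t) t x := by
  filter_upwards [ae_backwardInt_eq (fun s hs => hg s (hs.trans ht))
    (fun s hs => hK s (hs.trans ht))] with x hx
  rw [F_one_eq, hx _ (fun _ => x) rfl]
  intro z' hz'
  rw [hz' t le_rfl]

/-- `F` equals the forward mass only almost everywhere for the filter. The filter recursion
transfers this to `φ_t` followed by `MG`, as its constant is neither `0` nor `∞`; the forward mass
then satisfies the one-step recursion by definition. -/
lemma lintegral_F_one_succ {t T : ℕ} (ht : t < T) (hg : ∀ s ≤ T, ∀ x, 0 < H.g s x) {K : ℝ≥0}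
    (hK : ∀ s ≤ T, ∀ x, H.g s x ≤ K) :
    ∫⁻ x, ∫⁻ x', H.F (t + 1) T x' (fun _ => 1) ∂H.MG (t + 1) x ∂H.filt t =
      ∫⁻ x, H.F t T x (fun _ => 1) ∂H.filt t := by
  obtain ⟨c, h0, h1, hc⟩ := exists_lintegral_filt_succ (fun s hs => hg s (hs.trans ht))
    (fun s hs => hK s (hs.trans ht))
  have e : ∫⁻ x, ∫⁻ x', H.F (t + 1) T x' (fun _ => 1) ∂H.MG (t + 1) x ∂H.filt t =
      ∫⁻ x, ∫⁻ x', H.fwdMass (T - (t + 1)) (t + 1) x' ∂H.MG (t + 1) x ∂H.filt t := by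
    have := lintegral_congr_ae (ae_F_one_eq (Nat.succ_le_of_lt ht) hg hK)
    rw [hc _ (measurable_F_one _ _), hc _ (measurable_fwdMass _ _)] at this
    exact (ENNReal.mul_right_inj h0 h1).1 this
  rw [e, lintegral_congr_ae (ae_F_one_eq ht.le hg hK), show T - t = T - (t + 1) + 1 by omega]
  rfl

lemma integral_F_one_succ {t T : ℕ} (ht : t < T) (hg : ∀ s ≤ T, ∀ x, 0 < H.g s x) {K : ℝ≥0}
    (hK : ∀ s ≤ T, ∀ x, H.g s x ≤ K) :
    ∫ z, H.fwd t (fun z => (H.F (t + 1) T (z (Fin.last (t + 1))) (fun _ => 1)).toReal) z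
        ∂H.smooth t = ∫ x, (H.F t T x (fun _ => 1)).toReal ∂H.filt t := by
  have hlt : ∀ s ≤ T, ∀ x, H.F s T x (fun _ => 1) < ∞ := fun s hs x =>
    (F_one_le hs hK x).trans_lt (ENNReal.pow_lt_top ENNReal.coe_lt_top)
  have := isProbabilityMeasure_filt (fun s hs => hg s (hs.trans ht.le))
    (fun s hs => hK s (hs.trans ht.le))
  have hin : ∀ x, ∫ x', (H.F (t + 1) T x' (fun _ => 1)).toReal ∂H.MG (t + 1) x =
      (∫⁻ x', H.F (t + 1) T x' (fun _ => 1) ∂H.MG (t + 1) x).toReal := fun x =>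
    integral_toReal (measurable_F_one _ _).aemeasurable (ae_of_all _ fun x => hlt _ ht x)
  have hM : Measurable fun x => ∫⁻ x', H.F (t + 1) T x' (fun _ => 1) ∂H.MG (t + 1) x :=
    (measurable_F_one (t + 1) T).lintegral_kernel
  simp only [fwd, Fin.snoc_last, hin]
  rw [integral_toReal (measurable_F_one _ _).aemeasurable (ae_of_all _ fun x => hlt _ ht.le x),
    ← lintegral_F_one_succ ht hg hK, ← integral_toReal hM.aemeasurable, filt,
    integral_map (measurable_pi_apply _).aemeasurable hM.ennreal_toReal.aestronglyMeasurable]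
  refine ae_of_all _ fun x => ?_
  have := isFiniteKernel_MG (hK (t + 1) ht)
  refine (lintegral_mono fun x' => F_one_le (Nat.succ_le_of_lt ht) hK x').trans_lt ?_
  rw [lintegral_const]
  exact ENNReal.mul_lt_top (ENNReal.pow_lt_top ENNReal.coe_lt_top) (measure_lt_top _ _)

end HMM

/-! ### Assembly of the theorem -/

lemma abs_sub_le_osc {Z : Type*} {h : Z → ℝ} (hb : ∃ c, ∀ x, |h x| ≤ c) (x x' : Z) :
    |h x - h x'| ≤ osc h := by
  obtain ⟨c, hc⟩ := hb
  refine le_ciSup (f := fun p : Z × Z => |h p.1 - h p.2|) ⟨c + c, ?_⟩ (x, x')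
  rintro _ ⟨p, rfl⟩
  exact (abs_sub _ _).trans (add_le_add (hc _) (hc _))

namespace Proposal

universe u

variable {X Y : Type*} [MeasurableSpace X] [MeasurableSpace Y] {H : HMM X Y} {Q : Proposal H}
  {T : ℕ}

/-- The boundedness and positivity conditions, with positive bounds. -/
structure BoundedUpTo (Q : Proposal H) (T : ℕ) (Kg Kϑ K₀ Kw : ℝ≥0) : Prop where
  g_pos : ∀ t ≤ T, ∀ x, 0 < H.g t x
  g_le : ∀ t ≤ T, ∀ x, H.g t x ≤ Kg
  ϑ_le : ∀ t, 1 ≤ t → t ≤ T → ∀ x, Q.ϑ t x ≤ Kϑ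
  w₀_le : ∀ᵐ x ∂Q.ρ₀, Q.w₀ x ≤ K₀
  w_le : ∀ t, 1 ≤ t → t ≤ T → ∀ x x', Q.w t x x' ≤ Kw
  Kg_pos : 0 < Kg
  Kϑ_pos : 0 < Kϑ
  K₀_pos : 0 < K₀
  Kw_pos : 0 < Kw

namespace BoundedUpTo

variable {Kg Kϑ K₀ Kw : ℝ≥0}

lemma unnormDeviation_succ (hQ : Q.BoundedUpTo T Kg Kϑ K₀ Kw) {t : ℕ} (ht : t < T)
    (h : EstDeviation.{u} Q T t) :
    UnnormDeviation.{u} Q T (t + 1) (fun k => (∫ z, H.fwd t k z ∂H.smooth t) /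
      ∫ z, (Q.ϑ (t + 1) (z (Fin.last t)) : ℝ) ∂H.smooth t) :=
  h.unnormDeviation_succ ht (fun s hs => hQ.g_pos s (hs.trans ht.le)) hQ.Kg_pos hQ.Kϑ_pos
    hQ.Kw_pos (fun s hs => hQ.g_le s (hs.trans ht)) (hQ.ϑ_le _ (Nat.le_add_left 1 t) ht)
    (hQ.w_le _ (Nat.le_add_left 1 t) ht)

lemma integral_ϑ_pos (hQ : Q.BoundedUpTo T Kg Kϑ K₀ Kw) {t : ℕ} (ht : t < T) :
    0 < ∫ z, (Q.ϑ (t + 1) (z (Fin.last t)) : ℝ) ∂H.smooth t := by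
  have := HMM.isProbabilityMeasure_smooth (fun s hs => hQ.g_pos s (hs.trans ht.le))
    (fun s hs => hQ.g_le s (hs.trans ht.le))
  refine HMM.integral_pos_of_pos (HMM.integrable_of_abs_le (c := Kϑ)
    ((Q.measurable_ϑ (t + 1)).comp (measurable_pi_apply _)).coe_nnreal_real fun z => ?_)
    fun z => by exact_mod_cast Q.ϑ_pos _ _
  rw [abs_of_nonneg (by positivity)]
  exact_mod_cast hQ.ϑ_le _ (Nat.le_add_left 1 t) ht _

lemma estDeviation_and_extinctionBound (hQ : Q.BoundedUpTo T Kg Kϑ K₀ Kw) {t : ℕ} (ht : t ≤ T) :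
    EstDeviation.{u} Q T t ∧ ExtinctionBound.{u} Q T (t + 1) := by
  induction t with
  | zero =>
    have hU := unnormDeviation_zero.{u} (T := T) hQ.K₀_pos hQ.w₀_le
    have hpos : 0 < ∫ x, (H.g 0 x : ℝ) ∂H.χ := by
      refine HMM.integral_pos_of_pos (HMM.integrable_of_abs_le (c := Kg)
        (H.measurable_g 0).coe_nnreal_real fun x => ?_)
        fun x => by exact_mod_cast hQ.g_pos 0 ht x
      rw [abs_of_nonneg (by positivity)]
      exact_mod_cast hQ.g_le 0 ht x
    exact ⟨hU.estDeviation ht hpos (by simp) fun k hk _ => HMM.integral_smooth_zero hk,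
      hU.extinctionBound_succ ht (by simpa using hpos) extinctionBound_zero⟩
  | succ t ih =>
    obtain ⟨hE, hX⟩ := ih (Nat.le_of_succ_le ht)
    have hg := fun s (hs : s ≤ t + 1) => hQ.g_pos s (hs.trans ht)
    have hK := fun s (hs : s ≤ t + 1) => hQ.g_le s (hs.trans ht)
    have hU := hQ.unnormDeviation_succ ht hE
    have hθ := hQ.integral_ϑ_pos (t := t) ht
    have hb := div_pos (HMM.integral_fwd_one_pos hg hK) hθ
    refine ⟨hU.estDeviation ht hb rfl fun k hk hk1 => ?_, hU.extinctionBound_succ ht hb hX⟩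
    rw [HMM.integral_smooth_succ hg hK hk hk1, div_div_div_cancel_right₀ (ne_of_gt hθ)]

/-- The exponential deviation inequality for the smoothing estimator. -/
theorem exists_deviation (hQ : Q.BoundedUpTo T Kg Kϑ K₀ Kw) :
    ∃ B C : ℝ, 0 < B ∧ 0 < C ∧
      ∀ (Ω : Type u) [MeasurableSpace Ω] (P : Measure Ω) [IsProbabilityMeasure P]
        (N : ℕ), 1 ≤ N → ∀ S : ParticleSystem Q T N P,
        P.real S.aliveᶜ ≤ B * Real.exp (-(C * N)) ∧
        ∀ (ε : ℝ), 0 < ε → ∀ (h : (Fin (T + 1) → X) → ℝ), Measurable h →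
          (∃ c, ∀ x, |h x| ≤ c) →
          P.real (S.alive ∩ {ω | ε ≤ |S.ffbs h ω - ∫ x, h x ∂(H.smooth T)|})
              ≤ B * Real.exp (-(C * N * ε ^ 2 / osc h ^ 2)) ∧
          (osc h = 0 →
            P.real (S.alive ∩ {ω | ε ≤ |S.ffbs h ω - ∫ x, h x ∂(H.smooth T)|}) = 0) := by
  have := HMM.isProbabilityMeasure_smooth hQ.g_pos hQ.g_le
  obtain ⟨⟨B, C, hB, hC, h⟩, B', C', hB', hC', hX⟩ :=
    hQ.estDeviation_and_extinctionBound.{u} le_rfl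
  refine ⟨B + B', min C C', by positivity, by positivity, ?_⟩
  intro Ω _ P _ N hN S
  refine ⟨?_, fun ε hε f hf hfb => ?_⟩
  · rw [S.alive_eq]
    refine (hX Ω P N hN S).trans ?_
    gcongr
    · linarith
    · exact min_le_right _ _
  obtain ⟨z₀⟩ : Nonempty (Fin (T + 1) → X) := nonempty_of_isProbabilityMeasure (H.smooth T)
  have hosc := fun z => abs_sub_le_osc hfb z z₀
  -- Exact reproduction of constants is what permits `osc f` in place of a bound on `|f|`.
  have hone : ∀ᵐ ω ∂P, ω ∈ S.alive → H.est (S.cloud ω) T (fun _ => 1) = 1 := by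
    filter_upwards [S.ae_reachable] with ω hω hal
    rw [S.alive_eq] at hal
    exact (hω T le_rfl (S.aliveBefore_anti (Nat.le_succ T) hal)).est_one
      (hal T (Nat.lt_succ_self T))
  have hnull : osc f = 0 →
      P.real (S.alive ∩ {ω | ε ≤ |S.ffbs f ω - ∫ x, f x ∂(H.smooth T)|}) = 0 := by
    intro h0
    have hc : f = fun _ => f z₀ * 1 := by
      funext z
      have := hosc z
      rw [h0] at this
      linarith [abs_nonpos_iff.1 this]
    refine (measureReal_eq_zero_iff).2 (measure_eq_zero_iff_ae_notMem.2 ?_)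
    filter_upwards [hone] with ω hω
    rintro ⟨hal, hdev⟩
    simp only [Set.mem_ofPred_eq] at hdev
    rw [S.ffbs_eq_est, hc, HMM.est_const_mul, hω hal] at hdev
    simp at hdev
    linarith
  refine ⟨?_, hnull⟩
  rcases eq_or_ne (osc f) 0 with h0 | h0
  · rw [hnull h0]; positivity
  have hpos : 0 < osc f := lt_of_le_of_ne ((abs_nonneg _).trans (hosc z₀)) h0.symm
  -- Centring at one value of `f` and dividing by the oscillation brings the function into the unit
  -- ball.
  set k : (Fin (T + 1) → X) → ℝ := fun z => (f z - f z₀) / osc f with hk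
  have hkm : Measurable k := (hf.sub_const _).div_const _
  have hk1 : ∀ z, |k z| ≤ 1 := fun z => by
    rw [hk, abs_div, abs_of_pos hpos, div_le_one hpos]; exact hosc z
  have hfk : f = fun z => osc f * k z + f z₀ * 1 := by
    funext z; simp only [hk]; field_simp; ring
  have h_integral : ∫ z, f z ∂H.smooth T = osc f * (∫ z, k z ∂H.smooth T) + f z₀ := by
    rw [integral_congr_ae (ae_of_all _ (congrFun hfk)), integral_add
      ((HMM.integrable_of_abs_le hkm hk1).const_mul _) (integrable_const _), integral_const_mul]
    simp
  have hmain := h Ω P N hN S (ε / osc f) (by positivity) k hkm hk1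
  refine le_trans (ENNReal.toReal_mono (measure_ne_top _ _) (measure_mono_ae ?_))
    (hmain.trans ?_)
  · filter_upwards [hone] with ω hω
    rintro ⟨hal, hdev⟩
    refine ⟨S.alive_eq ▸ hal, ?_⟩
    have hest : S.ffbs f ω = osc f * H.est (S.cloud ω) T k + f z₀ := by
      rw [S.ffbs_eq_est]
      conv_lhs => rw [hfk]
      rw [HMM.est_linear, hω hal, mul_one]
    simp only [Set.mem_ofPred_eq] at hdev ⊢
    rw [hest, h_integral, add_sub_add_right_eq_sub, ← mul_sub, abs_mul, abs_of_pos hpos] at hdev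
    rwa [div_le_iff₀' hpos]
  · rw [div_pow, ← mul_div_assoc]
    gcongr
    · linarith
    · exact min_le_left _ _

/-- The law of large numbers for the weighted sums of `F_{t+1,T}(·, 1)`. -/
theorem tendstoInMeasure_weighted_F (hQ : Q.BoundedUpTo T Kg Kϑ K₀ Kw) {Ω : Type u}
    [MeasurableSpace Ω] {P : Measure Ω} [IsProbabilityMeasure P]
    (S : ∀ N : ℕ, ParticleSystem Q T N P) {t : ℕ} (ht : t < T) :
    TendstoInMeasure P
      (fun (N : ℕ) ω => (N : ℝ)⁻¹ * ∑ l : Fin N,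
        ((S N).weight (t + 1) l ω : ℝ) *
          (H.F (t + 1) T ((S N).ξ (t + 1) l ω) (fun _ => 1)).toReal)
      atTop
      (fun _ => (∫ x, (H.F t T x (fun _ => 1)).toReal ∂(H.filt t)) /
        ∫ x, (Q.ϑ (t + 1) x : ℝ) ∂(H.filt t)) := by
  obtain ⟨hE, B', C', hB', hC', hX⟩ := hQ.estDeviation_and_extinctionBound.{u} ht.le
  obtain ⟨B, C, hB, hC, h⟩ := hQ.unnormDeviation_succ ht hE
  set c : ℝ := (Kg : ℝ) ^ (T - (t + 1))
  have hc0 : 0 < c := pow_pos (by exact_mod_cast hQ.Kg_pos) _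
  set f : X → ℝ := fun x => (H.F (t + 1) T x (fun _ => 1)).toReal with hfdef
  have hfm : Measurable f := (HMM.measurable_F_one (t + 1) T).ennreal_toReal
  have hfc : ∀ x, |f x| ≤ c := fun x => by
    rw [abs_of_nonneg ENNReal.toReal_nonneg]
    have := HMM.F_one_le (H := H) ht hQ.g_le x
    rw [← ENNReal.coe_pow] at this
    exact_mod_cast ENNReal.toReal_le_coe_of_le_coe this
  -- `F_{t+1,T}(·, 1)` is at most `Kg ^ (T - (t + 1))`, one factor for each remaining likelihood.
  set k : (Fin (t + 2) → X) → ℝ := fun z => c⁻¹ * f (z (Fin.last (t + 1))) with hk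
  have hkm : Measurable k := (hfm.comp (measurable_pi_apply _)).const_mul _
  have hk1 : ∀ z, |k z| ≤ 1 := fun z => by
    rw [hk, abs_mul, abs_of_pos (inv_pos.2 hc0), inv_mul_le_iff₀ hc0, mul_one]
    exact hfc _
  have hmean : (∫ z, H.fwd t k z ∂H.smooth t) /
      (∫ z, (Q.ϑ (t + 1) (z (Fin.last t)) : ℝ) ∂H.smooth t) =
      c⁻¹ * ((∫ x, (H.F t T x (fun _ => 1)).toReal ∂(H.filt t)) /
        ∫ x, (Q.ϑ (t + 1) x : ℝ) ∂(H.filt t)) := by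
    have e : H.fwd t k = fun z => c⁻¹ * H.fwd t (fun z => f (z (Fin.last (t + 1)))) z := by
      funext z
      simp only [HMM.fwd, hk, integral_const_mul]
    rw [e, integral_const_mul, hfdef, HMM.integral_F_one_succ ht hQ.g_pos hQ.g_le, mul_div_assoc]
    congr 2
    rw [HMM.filt, integral_map (measurable_pi_apply _).aemeasurable
      (Q.measurable_ϑ _).coe_nnreal_real.aestronglyMeasurable]
  rw [tendstoInMeasure_iff_measureReal_norm]
  intro ε hε
  have hexp : ∀ b : ℝ, 0 < b → Tendsto (fun N : ℕ => Real.exp (-(b * N))) atTop (nhds 0) := by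
    intro b hb
    exact Real.tendsto_exp_neg_atTop_nhds_zero.comp
      (tendsto_natCast_atTop_atTop.const_mul_atTop hb)
  have hlim : Tendsto (fun N : ℕ => B' * Real.exp (-(C' * N)) +
      B * Real.exp (-((C * (c⁻¹ * ε) ^ 2) * N))) atTop (nhds 0) := by
    simpa using ((hexp C' hC').const_mul B').add
      ((hexp (C * (c⁻¹ * ε) ^ 2) (by positivity)).const_mul B)
  refine tendsto_of_tendsto_of_tendsto_of_le_of_le' tendsto_const_nhds hlim
    (Eventually.of_forall fun N => measureReal_nonneg) ?_
  filter_upwards [eventually_ge_atTop 1] with N hN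
  have e₁ := hX Ω P N hN (S N)
  have e₂ := h Ω P N hN (S N) (c⁻¹ * ε) (by positivity) k hkm hk1
  rw [mul_right_comm C] at e₂
  refine (measureReal_le_add_of_ae ?_).trans (add_le_add e₁ e₂)
  filter_upwards [(S N).ae_reachable] with ω hω hdev
  -- Survival through time `t` suffices: generation `t + 1` itself may have zero total weight.
  -- Earlier extinction leaves the sum uncontrolled but has vanishing probability.
  by_cases hal : ω ∈ (S N).aliveBefore (t + 1)
  · refine Or.inr ⟨hal, ?_⟩
    have hreach := hω (t + 1) ht hal
    have hU : H.unnormEst ((S N).cloud ω) (t + 1) k = c⁻¹ * ∑ l : Fin N,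
        ((S N).weight (t + 1) l ω : ℝ) * f ((S N).ξ (t + 1) l ω) := by
      rw [hk, hreach.unnormEst_last (fun x => c⁻¹ * f x), Finset.mul_sum]
      refine Finset.sum_congr rfl fun l _ => ?_
      simp only [ParticleSystem.cloud]
      ring
    simp only [Set.mem_ofPred_eq, Real.norm_eq_abs] at hdev ⊢
    rw [hmean, hU, mul_left_comm, ← mul_sub, abs_mul, abs_of_pos (inv_pos.2 hc0)]
    gcongr
  · exact Or.inl hal

end BoundedUpTo

end Proposal

theorem mainTheorem1 {X Y : Type*}
    [TopologicalSpace X] [PolishSpace X] [MeasurableSpace X] [BorelSpace X]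
    [TopologicalSpace Y] [PolishSpace Y] [MeasurableSpace Y] [BorelSpace Y]
    (H : HMM X Y) (Q : Proposal H) (T : ℕ)
    -- positive and bounded likelihoods
    (hg_pos : ∀ t ≤ T, ∀ x, 0 < H.g t x)
    (hg_bdd : ∃ K : ℝ≥0, ∀ t ≤ T, ∀ x, H.g t x ≤ K)
    -- bounded adjustment weights and importance weights
    (hϑ_bdd : ∃ K : ℝ≥0, ∀ t, 1 ≤ t → t ≤ T → ∀ x, Q.ϑ t x ≤ K)
    (hw₀_bdd : ∃ K : ℝ≥0, ∀ᵐ x ∂Q.ρ₀, Q.w₀ x ≤ K)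
    (hw_bdd : ∃ K : ℝ≥0, ∀ t, 1 ≤ t → t ≤ T → ∀ x x', Q.w t x x' ≤ K) :
    -- the exponential deviation inequality, with constants that do not depend on
    -- the number of particles, the level, the function or the run of the algorithm
    (∃ B C : ℝ, 0 < B ∧ 0 < C ∧
      ∀ (Ω : Type*) [MeasurableSpace Ω] (P : Measure Ω) [IsProbabilityMeasure P]
        (N : ℕ), 1 ≤ N → ∀ S : ParticleSystem Q T N P,
        -- the estimator is undefined with exponentially small probability only
        P.real S.aliveᶜ ≤ B * Real.exp (-(C * N)) ∧
        ∀ (ε : ℝ), 0 < ε → ∀ (h : (Fin (T + 1) → X) → ℝ), Measurable h →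
          (∃ c, ∀ x, |h x| ≤ c) →
          P.real (S.alive ∩ {ω | ε ≤ |S.ffbs h ω - ∫ x, h x ∂(H.smooth T)|})
              ≤ B * Real.exp (-(C * N * ε ^ 2 / osc h ^ 2)) ∧
          -- for `osc h = 0` the right-hand side is to be read as `B * exp (-∞) = 0`
          (osc h = 0 →
            P.real (S.alive ∩ {ω | ε ≤ |S.ffbs h ω - ∫ x, h x ∂(H.smooth T)|}) = 0)) ∧
    -- the law of large numbers for the weighted sums, at the times `t + 1 = 1, …, T`
    (∀ (Ω : Type*) [MeasurableSpace Ω] (P : Measure Ω) [IsProbabilityMeasure P]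
      (S : ∀ N : ℕ, ParticleSystem Q T N P), ∀ t < T,
      TendstoInMeasure P
        (fun (N : ℕ) ω => (N : ℝ)⁻¹ * ∑ l : Fin N,
          ((S N).weight (t + 1) l ω : ℝ) *
            (H.F (t + 1) T ((S N).ξ (t + 1) l ω) (fun _ => 1)).toReal)
        atTop
        (fun _ => (∫ x, (H.F t T x (fun _ => 1)).toReal ∂(H.filt t)) /
          ∫ x, (Q.ϑ (t + 1) x : ℝ) ∂(H.filt t))) := by
  obtain ⟨Kg, hKg⟩ := hg_bdd
  obtain ⟨Kϑ, hKϑ⟩ := hϑ_bdd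
  obtain ⟨K₀, hK₀⟩ := hw₀_bdd
  obtain ⟨Kw, hKw⟩ := hw_bdd
  -- Adding one makes every bound positive, as needed when dividing by it.
  have hQ : Q.BoundedUpTo T (Kg + 1) (Kϑ + 1) (K₀ + 1) (Kw + 1) :=
    ⟨hg_pos, fun t ht x => (hKg t ht x).trans le_self_add,
      fun t h1 ht x => (hKϑ t h1 ht x).trans le_self_add,
      hK₀.mono fun x hx => hx.trans le_self_add,
      fun t h1 ht x x1 => (hKw t h1 ht x x1).trans le_self_add,
      by positivity, by positivity, by positivity, by positivity⟩
  exact ⟨hQ.exists_deviation, fun Ω _ P _ S t ht => hQ.tendstoInMeasure_weighted_F S ht⟩
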